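/- Let $r\ge 2$, and let $\lambda$ be a positive integer or a real number greater than $5$. Consider $n\ge 1$ independent trials, each of which falls into exactly one of $r$ classes, class $j$ having probability $p_j>0$, where $\sum_{j=1}^r p_j=1$; let $U_j$ be the number of trials that fall into class $j$. The power divergence statistic with index $\lambda$ is $$T_\lambda=\frac{2}{\lambda(\lambda+1)}\sum_{j=1}^r U_j\bigg[\bigg(\frac{U_j}{np_j}\bigg)^{\lambda}-1\bigg].$$ Let $C_b^6(\mathbb{R}^+)$ be the class of functions $h:[0,\infty)\to\mathbb{R}$ that are six times differentiable (with one-sided derivatives at $0$) and whose derivatives of orders $1,\ldots,6$ are bounded. With $\|h^{(k)}\|=\sup_{x\ge0}|h^{(k)}(x)|$ and ${m\brace k}$ the Stirling numbers of the second kind, put $$h_6=\sum_{k=1}^6{6\brace k}\|h^{(k)}\|,\qquad \tilde h_3=\sum_{k=1}^3{3\brace k}\big(2^3\|h^{(k)}\|+\|h^{(k+1)}\|\big).$$ Then for every $h\in C_b^6(\mathbb{R}^+)$ the expectations $\mathbb{E}h(T_\lambda)$ and $\mathbb{E}h(Y)$, where $Y\sim\chi^2_{(r-1)}$, exist, and $$|\mathbb{E}h(T_\lambda)-\mathbb{E}h(Y)|\le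 C(\lambda,p_1,\ldots,p_r)\,r^7n^{-1}(h_6+\tilde h_3),$$ where $C(\lambda,p_1,\ldots,p_r)$ depends only on $\lambda$ and the finite sequence $p_1,\ldots,p_r$; in particular it does not depend on $n$ or $h$. -/

import Mathlib

open MeasureTheory ProbabilityTheory

noncomputable section

/-- The half-line `ℝ⁺ = [0, ∞)` on which the test functions live. -/
abbrev halfLine : Set ℝ := Set.Ici 0

/-- The class `C_b^m(ℝ⁺)`: `h` is `m` times differentiable on `[0, ∞)` (one-sided derivatives at
`0`), and its derivatives of orders `1, …, m` are bounded there. Neither boundedness of `h` itself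
nor continuity of the top derivative is required. -/
structure MemCb (m : ℕ) (h : ℝ → ℝ) : Prop where
  differentiableOn : ∀ k < m, DifferentiableOn ℝ (iteratedDerivWithin k h halfLine) halfLine
  bounded : ∀ k, 1 ≤ k → k ≤ m →
    ∃ M : ℝ, ∀ x ∈ halfLine, |iteratedDerivWithin k h halfLine x| ≤ M

/-- The supremum norm `‖h^{(k)}‖` of the `k`-th derivative over `[0, ∞)`. -/
def derivNorm (h : ℝ → ℝ) (k : ℕ) : ℝ :=
  ⨆ x : halfLine, |iteratedDerivWithin k h halfLine x|

/-- `h_m = ∑_{k=1}^m S(m,k) ‖h^{(k)}‖`, with `S` the Stirling numbers of the second kind. -/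
def hNorm (m : ℕ) (h : ℝ → ℝ) : ℝ :=
  ∑ k ∈ Finset.Icc 1 m, (Nat.stirlingSecond m k : ℝ) * derivNorm h k

/-- `h̃_m = ∑_{k=1}^m S(m,k) (2^m ‖h^{(k)}‖ + ‖h^{(k+1)}‖)`. -/
def hTildeNorm (m : ℕ) (h : ℝ → ℝ) : ℝ :=
  ∑ k ∈ Finset.Icc 1 m,
    (Nat.stirlingSecond m k : ℝ) * (2 ^ m * derivNorm h k + derivNorm h (k + 1))

/-- The number of trials that fall in class `j`, when `x i` is the class of the `i`-th trial. -/
def cellCount {n r : ℕ} (x : Fin n → Fin r) (j : Fin r) : ℕ :=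
  (Finset.univ.filter fun i => x i = j).card

/-- The power divergence statistic with index `lam` of the outcome `x` of `n` trials, for the
classification probabilities `p`. -/
def powerDivergence {n r : ℕ} (lam : ℝ) (p : Fin r → ℝ) (x : Fin n → Fin r) : ℝ :=
  2 / (lam * (lam + 1)) *
    ∑ j, (cellCount x j : ℝ) * (((cellCount x j : ℝ) / (n * p j)) ^ lam - 1)

/-- The chi-square distribution with `d` degrees of freedom: the law of `Z_1² + ⋯ + Z_d²` for
independent standard normal `Z_1, …, Z_d`. -/
def chiSquare (d : ℕ) : Measure ℝ :=
  (Measure.pi fun _ : Fin d => gaussianReal 0 1).map fun z => ∑ i, z i ^ 2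

end

/-! ### Taylor expansion along a segment -/

/-! Put d = r - 1 and s = n^{-1/2}. Choose an orthonormal frame `B` of the hyperplane orthogonal to
(√p_j), and give a trial in class j the score B_j/√p_j in ℝ^d. Scores have mean 0 and identity
covariance, and their normalized sum W over the n trials satisfies (BW)_j = (U_j - n p_j)/√(n p_j),
so Pearson's statistic is exactly |W|². Taylor's formula for (1 + y)^{λ+1} then gives, for every λ >
0, T_λ = |W|² + s c(W) + O(s² (1 + ‖W‖)^N) with an odd cubic form c (`powerDivergence_expansion`).
Hence h(T_λ) = h(|W|²) + s h'(|W|²) c(W) + O(s²) up to a weight in W (`test_function_expansion`).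

It remains to compare W with a standard Gaussian Z, where |Z|² is chi-square. The Lindeberg method
replaces the scores one at a time by Gaussian increments. Since means and covariances agree, one
replacement costs O(s³), and n = s^{-2} of them cost O(s) (`clt_first_order`). The function h'(|v|²)
c(v) is odd, so its Gaussian mean vanishes and its mean at W is O(s); the prefactor s makes this
O(1/n). The function h(|v|²) is even: its third-order term in one replacement is s³ times an odd
function, whose mean is again O(s) by the first-order result. So one replacement costs O(s⁴) in the
mean, and n of them cost O(s²) = O(1/n) (`clt_second_order`).

All remainders are controlled by the weight `expWeight`, whose mean stays bounded along the
replacements. Estimates are stated for families indexed by the test function h, with bounds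
proportional to `hNorm 6 h`; this makes every constant independent of h. As the constant may depend
on p, hence on r, the factor r⁷ ≥ 1 and the term h̃_3 ≥ 0 only enlarge the right-hand side. -/

theorem abs_sub_taylor_sum_le {m : ℕ} {K : ℝ} : ∀ (φ : ℕ → ℝ → ℝ),
    (∀ k < m, ∀ t ∈ Set.Icc (0 : ℝ) 1, HasDerivAt (φ k) (φ (k + 1) t) t) →
    (∀ t ∈ Set.Icc (0 : ℝ) 1, |φ m t| ≤ K) →
    ∀ t ∈ Set.Icc (0 : ℝ) 1,
      |φ 0 t - ∑ k ∈ Finset.range m, φ k 0 * (t ^ k / k.factorial)| ≤ K := by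
  induction m with
  | zero => intro φ _ hb t ht; simpa using hb t ht
  | succ m ih =>
    intro φ hφ hb t ht
    -- The induction hypothesis for the shifted family bounds the derivative of the remainder `g`.
    -- Since g(0) = 0 and the interval has length 1, the mean value inequality passes the same `K`
    -- on to `g`; the factor 1/m! is given up.
    have h1 := ih (fun k => φ (k + 1)) (fun k hk => hφ (k + 1) (by omega)) hb
    set g : ℝ → ℝ := fun t => φ 0 t - ∑ k ∈ Finset.range (m + 1), φ k 0 * (t ^ k / k.factorial)
    have hg0 : g 0 = 0 := by
      simp [g, Finset.sum_range_succ']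
    have hg : ∀ t ∈ Set.Icc (0 : ℝ) 1, HasDerivAt g
        (φ 1 t - ∑ k ∈ Finset.range m, φ (k + 1) 0 * (t ^ k / k.factorial)) t := by
      intro t ht
      refine (hφ 0 (by omega) t ht).sub ?_
      have hs : ∀ k ∈ Finset.range (m + 1), HasDerivAt
          (fun t : ℝ => φ k 0 * (t ^ k / k.factorial))
          (φ k 0 * ((k : ℝ) * t ^ (k - 1) / k.factorial)) t := by
        intro k _
        simpa using ((hasDerivAt_pow k t).div_const (k.factorial : ℝ)).const_mul (φ k 0)
      convert! HasDerivAt.fun_sum hs using 1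
      rw [Finset.sum_range_succ']
      simp only [Nat.cast_zero, zero_mul, zero_div, mul_zero, add_zero]
      refine Finset.sum_congr rfl fun k _ => ?_
      rw [Nat.factorial_succ]
      push_cast
      have : (k.factorial : ℝ) ≠ 0 := by positivity
      have : (k : ℝ) + 1 ≠ 0 := by positivity
      field_simp
    have hK : 0 ≤ K := (abs_nonneg _).trans (hb 0 (by simp))
    have := norm_image_sub_le_of_norm_deriv_le_segment' (f := g)
      (f' := fun t => φ 1 t - ∑ k ∈ Finset.range m, φ (k + 1) 0 * (t ^ k / k.factorial))
      (C := K) (a := 0) (b := 1) (fun x hx => (hg x hx).hasDerivWithinAt)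
      (fun x hx => h1 x ⟨hx.1, hx.2.le⟩) t ht
    rw [hg0] at this
    simp only [sub_zero, Real.norm_eq_abs] at this
    exact this.trans (by nlinarith [ht.2])

/-! ### Partial derivatives, parity and Taylor's formula on ℝ^d. -/

section Gradient

variable {d : ℕ}

/-- `f' a` is the partial derivative of `f` in direction `a`, and `f` is differentiable. -/
def HasGrad (f : (Fin d → ℝ) → ℝ) (f' : Fin d → (Fin d → ℝ) → ℝ) : Prop :=
  ∀ v, HasFDerivAt f (∑ a, f' a v • ContinuousLinearMap.proj (R := ℝ) (φ := fun _ => ℝ) a) v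

variable {f : (Fin d → ℝ) → ℝ} {f' : Fin d → (Fin d → ℝ) → ℝ}

theorem HasGrad.continuous (h : HasGrad f f') : Continuous f :=
  continuous_iff_continuousAt.2 fun v => (h v).continuousAt

theorem HasGrad.line (h : HasGrad f f') (v y : Fin d → ℝ) (t : ℝ) :
    HasDerivAt (fun t : ℝ => f (v + t • y)) (∑ a, y a * f' a (v + t • y)) t := by
  have h1 : HasDerivAt (fun t : ℝ => v + t • y) y t := by
    simpa using ((hasDerivAt_id t).smul_const y).const_add v
  have h2 := (h (v + t • y)).comp_hasDerivAt t h1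
  convert! h2 using 1
  simp [mul_comm]

theorem HasGrad.unique {f'' : Fin d → (Fin d → ℝ) → ℝ} (h : HasGrad f f') (h' : HasGrad f f'')
    (a : Fin d) (v : Fin d → ℝ) : f' a v = f'' a v := by
  have := congrArg (fun L => L (Pi.single a 1)) ((h v).unique (h' v))
  simpa [sum_apply, Pi.single_apply] using this

theorem HasGrad.neg_comp (h : HasGrad f f') : HasGrad (fun v => f (-v)) (fun a v => -f' a (-v)) := by
  intro v
  have h2 := (h (-v)).comp v ((hasFDerivAt_id (𝕜 := ℝ) v).neg)
  refine h2.congr_fderiv ?_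
  ext y
  simp [sum_apply]

theorem HasGrad.const_mul (c : ℝ) (h : HasGrad f f') :
    HasGrad (fun v => c * f v) (fun a v => c * f' a v) := by
  intro v
  refine ((h v).const_mul c).congr_fderiv ?_
  ext y
  simp [sum_apply, Finset.mul_sum, mul_assoc]

theorem HasGrad.add {g : (Fin d → ℝ) → ℝ} {g' : Fin d → (Fin d → ℝ) → ℝ} (h : HasGrad f f')
    (hg : HasGrad g g') : HasGrad (fun v => f v + g v) (fun a v => f' a v + g' a v) := by
  intro v
  refine ((h v).add (hg v)).congr_fderiv ?_
  ext y
  simp [sum_apply, Finset.sum_add_distrib, add_mul]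

theorem hasGrad_zero : HasGrad (fun _ : Fin d → ℝ => 0) (fun _ _ => 0) := by
  intro v
  simpa using hasFDerivAt_const (0 : ℝ) v

theorem HasGrad.coord_mul (b : Fin d) (h : HasGrad f f') :
    HasGrad (fun v => v b * f v) (fun a v => (if a = b then 1 else 0) * f v + v b * f' a v) := by
  intro v
  have hb : HasFDerivAt (fun v : Fin d → ℝ => v b)
    (ContinuousLinearMap.proj (R := ℝ) (φ := fun _ => ℝ) b) v :=
    (ContinuousLinearMap.proj (R := ℝ) (φ := fun _ => ℝ) b).hasFDerivAt
  refine (hb.mul (h v)).congr_fderiv ?_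
  ext y
  simp [sum_apply, Finset.sum_add_distrib, add_mul, Finset.mul_sum, mul_assoc]
  ring

/-- Differentiation flips parity: the chain rule for v ↦ -v gives a second gradient of the same
function, and gradients are unique. -/
theorem HasGrad.odd_of_even (h : HasGrad f f') (hf : ∀ v, f (-v) = f v) (a : Fin d)
    (v : Fin d → ℝ) : f' a (-v) = -f' a v := by
  have h2 := h.neg_comp
  simp only [hf] at h2
  have := h.unique h2 a v
  linarith

theorem HasGrad.even_of_odd (h : HasGrad f f') (hf : ∀ v, f (-v) = -f v) (a : Fin d)
    (v : Fin d → ℝ) : f' a (-v) = f' a v := by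
  have h2 := (h.const_mul (-1)).neg_comp
  have e : (fun v => -1 * f (-v)) = f := by funext v; rw [hf]; ring
  rw [e] at h2
  have := h.unique h2 a v
  linarith

theorem HasGrad.line_sum {κ : Type*} (s : Finset κ) {F : κ → (Fin d → ℝ) → ℝ}
    {F' : κ → Fin d → (Fin d → ℝ) → ℝ} (h : ∀ k ∈ s, HasGrad (F k) (F' k)) (c : κ → ℝ)
    (v y : Fin d → ℝ) (t : ℝ) :
    HasDerivAt (fun t : ℝ => ∑ k ∈ s, c k * F k (v + t • y))
      (∑ k ∈ s, ∑ a, c k * y a * F' k a (v + t • y)) t := by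
  have := HasDerivAt.fun_sum (u := s) fun k hk => ((h k hk).line v y t).const_mul (c k)
  simpa only [Finset.mul_sum, mul_assoc] using this

variable {f1 : Fin d → (Fin d → ℝ) → ℝ} {f2 : Fin d → Fin d → (Fin d → ℝ) → ℝ}
  {f3 : Fin d → Fin d → Fin d → (Fin d → ℝ) → ℝ}
  {f4 : Fin d → Fin d → Fin d → Fin d → (Fin d → ℝ) → ℝ}

/-- The directional derivatives of orders at most four along `t ↦ v + t y`. -/
def lineDerivs (f : (Fin d → ℝ) → ℝ) (f1 : Fin d → (Fin d → ℝ) → ℝ)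
    (f2 : Fin d → Fin d → (Fin d → ℝ) → ℝ) (f3 : Fin d → Fin d → Fin d → (Fin d → ℝ) → ℝ)
    (f4 : Fin d → Fin d → Fin d → Fin d → (Fin d → ℝ) → ℝ) (y w : Fin d → ℝ) : ℕ → ℝ
  | 0 => f w
  | 1 => ∑ a, y a * f1 a w
  | 2 => ∑ a, ∑ b, y a * y b * f2 a b w
  | 3 => ∑ a, ∑ b, ∑ c, y a * y b * y c * f3 a b c w
  | _ => ∑ a, ∑ b, ∑ c, ∑ e, y a * y b * y c * y e * f4 a b c e w

theorem lineDerivs_hasDerivAt_zero (h0 : HasGrad f f1) (v y : Fin d → ℝ) (t : ℝ) :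
    HasDerivAt (fun t : ℝ => lineDerivs f f1 f2 f3 f4 y (v + t • y) 0)
      (lineDerivs f f1 f2 f3 f4 y (v + t • y) 1) t := by
  simpa only [lineDerivs] using h0.line v y t

theorem lineDerivs_hasDerivAt_one (h1 : ∀ a, HasGrad (f1 a) (f2 a)) (v y : Fin d → ℝ) (t : ℝ) :
    HasDerivAt (fun t : ℝ => lineDerivs f f1 f2 f3 f4 y (v + t • y) 1)
      (lineDerivs f f1 f2 f3 f4 y (v + t • y) 2) t := by
  simpa only [lineDerivs] using HasGrad.line_sum Finset.univ (fun a _ => h1 a) y v y t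

theorem lineDerivs_hasDerivAt_two (h2 : ∀ a b, HasGrad (f2 a b) (f3 a b)) (v y : Fin d → ℝ)
    (t : ℝ) :
    HasDerivAt (fun t : ℝ => lineDerivs f f1 f2 f3 f4 y (v + t • y) 2)
      (lineDerivs f f1 f2 f3 f4 y (v + t • y) 3) t := by
  simp only [lineDerivs]
  exact HasDerivAt.fun_sum fun a _ =>
    HasGrad.line_sum Finset.univ (fun b _ => h2 a b) (fun b => y a * y b) v y t

theorem lineDerivs_hasDerivAt_three (h3 : ∀ a b c, HasGrad (f3 a b c) (f4 a b c))
    (v y : Fin d → ℝ) (t : ℝ) :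
    HasDerivAt (fun t : ℝ => lineDerivs f f1 f2 f3 f4 y (v + t • y) 3)
      (lineDerivs f f1 f2 f3 f4 y (v + t • y) 4) t := by
  simp only [lineDerivs]
  exact HasDerivAt.fun_sum fun a _ => HasDerivAt.fun_sum fun b _ =>
    HasGrad.line_sum Finset.univ (fun c _ => h3 a b c) (fun c => y a * y b * y c) v y t

theorem abs_sum_fin_le {F : Fin d → ℝ} {A : ℝ} (h : ∀ a, |F a| ≤ A) : |∑ a, F a| ≤ d * A := by
  calc |∑ a, F a| ≤ ∑ a, |F a| := Finset.abs_sum_le_sum_abs _ _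
    _ ≤ ∑ _a : Fin d, A := Finset.sum_le_sum fun a _ => h a
    _ = d * A := by simp

theorem abs_coord_le (y : Fin d → ℝ) (a : Fin d) : |y a| ≤ ‖y‖ := norm_le_pi_norm y a

theorem norm_segment_le {t : ℝ} (ht : t ∈ Set.Icc (0 : ℝ) 1) (v y : Fin d → ℝ) :
    ‖v + t • y‖ ≤ ‖v‖ + ‖y‖ := by
  refine (norm_add_le _ _).trans ?_
  rw [norm_smul, Real.norm_eq_abs, abs_of_nonneg ht.1]
  nlinarith [norm_nonneg y, ht.2]

/-- One-dimensional Taylor along t ↦ v + ty. The segment stays in the ball of radius ‖v‖ + ‖y‖, so a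
bound there suffices; d³ counts the third partials. -/
theorem taylor_three (h0 : HasGrad f f1) (h1 : ∀ a, HasGrad (f1 a) (f2 a))
    (h2 : ∀ a b, HasGrad (f2 a b) (f3 a b)) {B : ℝ} (v y : Fin d → ℝ)
    (hB : ∀ a b c w, ‖w‖ ≤ ‖v‖ + ‖y‖ → |f3 a b c w| ≤ B) :
    |f (v + y) - (f v + ∑ a, y a * f1 a v + (∑ a, ∑ b, y a * y b * f2 a b v) / 2)|
      ≤ d ^ 3 * (‖y‖ ^ 3 * B) := by
  have key := abs_sub_taylor_sum_le (m := 3) (K := d ^ 3 * (‖y‖ ^ 3 * B))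
    (fun k t => lineDerivs f f1 f2 f3 (fun _ _ _ _ _ => 0) y (v + t • y) k) ?_ ?_ 1 (by simp)
  · simpa [Finset.sum_range_succ, lineDerivs, div_eq_mul_inv, Nat.factorial] using key
  · intro k hk t _
    interval_cases k
    · exact lineDerivs_hasDerivAt_zero h0 v y t
    · exact lineDerivs_hasDerivAt_one h1 v y t
    · exact lineDerivs_hasDerivAt_two h2 v y t
  · intro t ht
    have hx : ∀ a b c, |y a * y b * y c * f3 a b c (v + t • y)| ≤ ‖y‖ ^ 3 * B := by
      intro a b c
      rw [abs_mul, abs_mul, abs_mul, pow_succ, pow_two]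
      have := hB a b c _ (norm_segment_le ht v y)
      gcongr <;> exact abs_coord_le y _
    calc _ ≤ (d : ℝ) * (d * (d * (‖y‖ ^ 3 * B))) :=
          abs_sum_fin_le fun a => abs_sum_fin_le fun b => abs_sum_fin_le fun c => hx a b c
      _ = _ := by ring

theorem taylor_four (h0 : HasGrad f f1) (h1 : ∀ a, HasGrad (f1 a) (f2 a))
    (h2 : ∀ a b, HasGrad (f2 a b) (f3 a b)) (h3 : ∀ a b c, HasGrad (f3 a b c) (f4 a b c))
    {B : ℝ} (v y : Fin d → ℝ)
    (hB : ∀ a b c e w, ‖w‖ ≤ ‖v‖ + ‖y‖ → |f4 a b c e w| ≤ B) :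
    |f (v + y) - (f v + ∑ a, y a * f1 a v + (∑ a, ∑ b, y a * y b * f2 a b v) / 2
        + (∑ a, ∑ b, ∑ c, y a * y b * y c * f3 a b c v) / 6)|
      ≤ d ^ 4 * (‖y‖ ^ 4 * B) := by
  have key := abs_sub_taylor_sum_le (m := 4) (K := d ^ 4 * (‖y‖ ^ 4 * B))
    (fun k t => lineDerivs f f1 f2 f3 f4 y (v + t • y) k) ?_ ?_ 1 (by simp)
  · simpa [Finset.sum_range_succ, lineDerivs, div_eq_mul_inv, Nat.factorial] using key
  · intro k hk t _
    interval_cases k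
    · exact lineDerivs_hasDerivAt_zero h0 v y t
    · exact lineDerivs_hasDerivAt_one h1 v y t
    · exact lineDerivs_hasDerivAt_two h2 v y t
    · exact lineDerivs_hasDerivAt_three h3 v y t
  · intro t ht
    have hx : ∀ a b c e, |y a * y b * y c * y e * f4 a b c e (v + t • y)| ≤ ‖y‖ ^ 4 * B := by
      intro a b c e
      rw [abs_mul, abs_mul, abs_mul, abs_mul, pow_succ, pow_succ, pow_two]
      have := hB a b c e _ (norm_segment_le ht v y)
      gcongr <;> exact abs_coord_le y _
    calc _ ≤ (d : ℝ) * (d * (d * (d * (‖y‖ ^ 4 * B)))) :=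
          abs_sum_fin_le fun a => abs_sum_fin_le fun b => abs_sum_fin_le fun c =>
            abs_sum_fin_le fun e => hx a b c e
      _ = _ := by ring

/-! ### Families of functions with uniformly polynomially bounded derivatives -/

variable {ι : Type*}

/-- The family `f` grows polynomially, with a bound proportional to `M`. -/
def PolyBdd (M : ι → ℝ) (f : ι → (Fin d → ℝ) → ℝ) : Prop :=
  ∃ (C : ℝ) (N : ℕ), 0 ≤ C ∧ ∀ i v, |f i v| ≤ C * M i * (1 + ‖v‖) ^ N

/-- The family `f` and its partial derivatives of orders at most `m` grow polynomially, with bounds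
proportional to `M`. -/
def UReg (M : ι → ℝ) : ℕ → (ι → (Fin d → ℝ) → ℝ) → Prop
  | 0, f => PolyBdd M f
  | m + 1, f => PolyBdd M f ∧ ∃ f' : Fin d → ι → (Fin d → ℝ) → ℝ,
      (∀ i, HasGrad (f i) fun a => f' a i) ∧ ∀ a, UReg M m (f' a)

variable {M : ι → ℝ} {F G : ι → (Fin d → ℝ) → ℝ} {m : ℕ}

theorem UReg.polyBdd (h : UReg M m F) : PolyBdd M F := by
  cases m with
  | zero => exact h
  | succ m => exact h.1

theorem UReg.of_succ (h : UReg M (m + 1) F) : UReg M m F := by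
  induction m generalizing F with
  | zero => exact h.1
  | succ m ih =>
    obtain ⟨hp, f', hf, hr⟩ := h
    exact ⟨hp, f', hf, fun a => ih (hr a)⟩

theorem UReg.continuous (h : UReg M (m + 1) F) (i : ι) : Continuous (F i) := by
  obtain ⟨_, f', hf, _⟩ := h
  exact (hf i).continuous

theorem PolyBdd.add (hM : ∀ i, 0 ≤ M i) (hF : PolyBdd M F) (hG : PolyBdd M G) :
    PolyBdd M fun i v => F i v + G i v := by
  obtain ⟨C, N, hC, h1⟩ := hF
  obtain ⟨C', N', hC', h2⟩ := hG
  refine ⟨C + C', N + N', by positivity, fun i v => ?_⟩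
  have hi := hM i
  have e1 : (1 + ‖v‖) ^ N ≤ (1 + ‖v‖) ^ (N + N') :=
    pow_le_pow_right₀ (by linarith [norm_nonneg v]) (by omega)
  have e2 : (1 + ‖v‖) ^ N' ≤ (1 + ‖v‖) ^ (N + N') :=
    pow_le_pow_right₀ (by linarith [norm_nonneg v]) (by omega)
  calc |F i v + G i v| ≤ C * M i * (1 + ‖v‖) ^ N + C' * M i * (1 + ‖v‖) ^ N' :=
        (abs_add_le _ _).trans (add_le_add (h1 i v) (h2 i v))
    _ ≤ C * M i * (1 + ‖v‖) ^ (N + N') + C' * M i * (1 + ‖v‖) ^ (N + N') := by gcongr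
    _ = _ := by ring

theorem PolyBdd.const_mul (c : ℝ) (hF : PolyBdd M F) :
    PolyBdd M fun i v => c * F i v := by
  obtain ⟨C, N, hC, h1⟩ := hF
  refine ⟨|c| * C, N, by positivity, fun i v => ?_⟩
  rw [abs_mul, mul_assoc, mul_assoc]
  have := h1 i v
  rw [mul_assoc] at this
  gcongr

theorem PolyBdd.coord_mul (hM : ∀ i, 0 ≤ M i) (b : Fin d) (hF : PolyBdd M F) :
    PolyBdd M fun i v => v b * F i v := by
  obtain ⟨C, N, hC, h1⟩ := hF
  refine ⟨C, N + 1, hC, fun i v => ?_⟩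
  have hi := hM i
  rw [abs_mul]
  calc |v b| * |F i v| ≤ (1 + ‖v‖) * (C * M i * (1 + ‖v‖) ^ N) := by
        gcongr
        · linarith [abs_coord_le v b]
        · exact h1 i v
    _ = _ := by ring

theorem UReg.add (hM : ∀ i, 0 ≤ M i) (hF : UReg M m F) (hG : UReg M m G) :
    UReg M m fun i v => F i v + G i v := by
  induction m generalizing F G with
  | zero => exact PolyBdd.add hM hF hG
  | succ m ih =>
    obtain ⟨hp, f', hf, hr⟩ := hF
    obtain ⟨hp', g', hg, hr'⟩ := hG
    exact ⟨hp.add hM hp', fun a i v => f' a i v + g' a i v, fun i => (hf i).add (hg i),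
      fun a => ih (hr a) (hr' a)⟩

theorem UReg.const_mul (c : ℝ) (hF : UReg M m F) :
    UReg M m fun i v => c * F i v := by
  induction m generalizing F with
  | zero => exact PolyBdd.const_mul c hF
  | succ m ih =>
    obtain ⟨hp, f', hf, hr⟩ := hF
    exact ⟨hp.const_mul c, fun a i v => c * f' a i v, fun i => (hf i).const_mul c,
      fun a => ih (hr a)⟩

theorem UReg.coord_mul (hM : ∀ i, 0 ≤ M i) (b : Fin d) (hF : UReg M m F) :
    UReg M m fun i v => v b * F i v := by
  induction m generalizing F with
  | zero => exact PolyBdd.coord_mul hM b hF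
  | succ m ih =>
    -- The product rule also produces `F` itself, which must therefore be regular to the same order
    -- as its gradient.
    have h := hF.of_succ
    obtain ⟨hp, f', hf, hr⟩ := hF
    exact ⟨hp.coord_mul hM b, fun a i v => (if a = b then 1 else 0) * F i v + v b * f' a i v,
      fun i => (hf i).coord_mul b, fun a => (h.const_mul _).add hM (ih (hr a))⟩

theorem uReg_zero : UReg M m fun _ (_ : Fin d → ℝ) => (0 : ℝ) := by
  have h0 : PolyBdd M fun _ (_ : Fin d → ℝ) => (0 : ℝ) := ⟨0, 0, le_rfl, by simp⟩
  induction m with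
  | zero => exact h0
  | succ m ih => exact ⟨h0, fun _ _ _ => 0, fun _ => hasGrad_zero, fun _ => ih⟩

theorem UReg.sum (hM : ∀ i, 0 ≤ M i) {κ : Type*} (s : Finset κ)
    {F : κ → ι → (Fin d → ℝ) → ℝ} (h : ∀ k ∈ s, UReg M m (F k)) :
    UReg M m fun i v => ∑ k ∈ s, F k i v := by
  classical
  induction s using Finset.induction_on with
  | empty => simpa using uReg_zero
  | insert k s hk ih =>
    simp only [Finset.sum_insert hk]
    exact (h k (by simp)).add hM (ih fun j hj => h j (by simp [hj]))

theorem UReg.linear_mul (hM : ∀ i, 0 ≤ M i) (c : Fin d → ℝ) (hF : UReg M m F) :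
    UReg M m fun i v => (∑ a, c a * v a) * F i v := by
  simp only [Finset.sum_mul, mul_assoc]
  exact UReg.sum hM _ fun a _ => (hF.coord_mul hM a).const_mul (c a)

end Gradient

/-! ### Functions of the squared Euclidean length. -/

section RadialFunctions

variable {d : ℕ} {ι : Type*} {M : ι → ℝ}

theorem sum_sq_le (v : Fin d → ℝ) : ∑ a, v a ^ 2 ≤ d * ‖v‖ ^ 2 := by
  have h : ∀ a, |v a ^ 2| ≤ ‖v‖ ^ 2 := fun a => by
    rw [abs_pow]
    exact pow_le_pow_left₀ (abs_nonneg _) (abs_coord_le v a) 2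
  exact (le_abs_self _).trans (abs_sum_fin_le h)

theorem sum_sq_nonneg (v : Fin d → ℝ) : 0 ≤ ∑ a, v a ^ 2 :=
  Finset.sum_nonneg fun a _ => sq_nonneg (v a)

/-- One-sided derivatives at 0 are enough for a full gradient, because |v|² never leaves the
half-line. -/
theorem hasGrad_comp_sum_sq {h h' : ℝ → ℝ}
    (hh : ∀ x, 0 ≤ x → HasDerivWithinAt h (h' x) halfLine x) :
    HasGrad (fun v : Fin d → ℝ => h (∑ a, v a ^ 2))
      (fun a v => v a * (2 * h' (∑ a, v a ^ 2))) := by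
  intro v
  have hq : HasFDerivAt (fun v : Fin d → ℝ => ∑ a, v a ^ 2)
      (∑ a, (2 * v a) • ContinuousLinearMap.proj (R := ℝ) (φ := fun _ => ℝ) a) v := by
    refine HasFDerivAt.fun_sum fun a _ => ?_
    have := ((ContinuousLinearMap.proj (R := ℝ) (φ := fun _ : Fin d => ℝ) a).hasFDerivAt
      (x := v)).pow 2
    refine this.congr_fderiv ?_
    ext y
    simp
  have hc := (hh _ (sum_sq_nonneg v)).comp_hasFDerivAt v hq
    (Filter.Eventually.of_forall fun w => sum_sq_nonneg w)
  refine hc.congr_fderiv ?_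
  ext y
  simp [Finset.mul_sum]
  refine Finset.sum_congr rfl fun a _ => ?_
  ring

/-- Sequences of successive derivatives on the half-line, of linear growth up to order `N`. -/
structure DerivSeq (M : ι → ℝ) (N : ℕ) (H : ι → ℕ → ℝ → ℝ) : Prop where
  hasDeriv : ∀ i, ∀ k < N, ∀ x, 0 ≤ x → HasDerivWithinAt (H i k) (H i (k + 1) x) halfLine x
  bound : ∀ i, ∀ k ≤ N, ∀ x, 0 ≤ x → |H i k x| ≤ M i * (1 + x)

/-- The gradient of H_k(|v|²) is 2v H_{k+1}(|v|²), so each order of regularity uses up one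
derivative of the sequence. -/
theorem DerivSeq.uReg (hM : ∀ i, 0 ≤ M i) {N : ℕ} {H : ι → ℕ → ℝ → ℝ} (hH : DerivSeq M N H)
    {m k : ℕ} (hk : k + m ≤ N) :
    UReg M m fun i (v : Fin d → ℝ) => H i k (∑ a, v a ^ 2) := by
  have hp : ∀ k ≤ N, PolyBdd M fun i (v : Fin d → ℝ) => H i k (∑ a, v a ^ 2) := by
    intro k hk
    refine ⟨d + 1, 2, by positivity, fun i v => (hH.bound i k hk _ (sum_sq_nonneg v)).trans ?_⟩
    rw [mul_comm ((d : ℝ) + 1), mul_assoc]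
    refine mul_le_mul_of_nonneg_left ?_ (hM i)
    have := sum_sq_le v
    have h0 := norm_nonneg v
    have hd : (0 : ℝ) ≤ d := by positivity
    nlinarith [mul_nonneg hd h0]
  induction m generalizing k with
  | zero => exact hp k hk
  | succ m ih =>
    refine ⟨hp k (by omega), fun a i v => v a * (2 * H i (k + 1) (∑ a, v a ^ 2)),
      fun i => hasGrad_comp_sum_sq (hH.hasDeriv i k (by omega)), fun a => ?_⟩
    exact ((ih (k := k + 1) (by omega)).const_mul 2).coord_mul hM a

end RadialFunctions

/-! ### An exponential weight dominating polynomial growth. -/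

section ExpWeight

variable {d : ℕ} {ι : Type*} {M : ι → ℝ}

/-- The weight `1 + ∑ (e^{v_a} + e^{-v_a})`. -/
noncomputable def expWeight (v : Fin d → ℝ) : ℝ :=
  1 + ∑ a, (Real.exp (v a) + Real.exp (-v a))

theorem one_le_expWeight (v : Fin d → ℝ) : 1 ≤ expWeight v := by
  unfold expWeight
  have : 0 ≤ ∑ a, (Real.exp (v a) + Real.exp (-v a)) :=
    Finset.sum_nonneg fun a _ => by positivity
  linarith

theorem continuous_expWeight : Continuous (expWeight (d := d)) := by
  unfold expWeight
  fun_prop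

theorem exp_norm_le_expWeight (v : Fin d → ℝ) : Real.exp ‖v‖ ≤ expWeight v := by
  by_cases hd : d = 0
  · subst hd
    have : v = 0 := Subsingleton.elim _ _
    rw [this, norm_zero, Real.exp_zero]
    exact one_le_expWeight 0
  have : Nonempty (Fin d) := ⟨⟨0, by omega⟩⟩
  obtain ⟨a, ha⟩ : ∃ a, ‖v‖ = |v a| := by
    obtain ⟨a, -, ha⟩ := Finset.exists_mem_eq_sup' (s := (Finset.univ : Finset (Fin d)))
      Finset.univ_nonempty (fun a => ‖v a‖)
    refine ⟨a, le_antisymm ?_ (abs_coord_le v a)⟩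
    rw [pi_norm_le_iff_of_nonneg (abs_nonneg _)]
    intro b
    have : ‖v b‖ ≤ Finset.univ.sup' Finset.univ_nonempty (fun a => ‖v a‖) :=
      Finset.le_sup' (fun a => ‖v a‖) (Finset.mem_univ b)
    rw [ha] at this
    exact this
  have h1 : Real.exp (v a) + Real.exp (-v a) ≤ ∑ a, (Real.exp (v a) + Real.exp (-v a)) :=
    Finset.single_le_sum (f := fun a => Real.exp (v a) + Real.exp (-v a))
      (fun a _ => by positivity) (Finset.mem_univ a)
  have h2 : Real.exp |v a| ≤ Real.exp (v a) + Real.exp (-v a) := by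
    rcases abs_cases (v a) with h | h <;> rw [h.1] <;>
      linarith [Real.exp_pos (v a), Real.exp_pos (-v a)]
  rw [ha]
  unfold expWeight
  linarith

theorem expWeight_add_le (v y : Fin d → ℝ) :
    expWeight (v + y) ≤ expWeight v * Real.exp ‖y‖ := by
  unfold expWeight
  rw [add_mul, Finset.sum_mul]
  refine add_le_add ?_ (Finset.sum_le_sum fun a _ => ?_)
  · rw [one_mul]
    exact Real.one_le_exp (norm_nonneg y)
  · have h := abs_le.1 (abs_coord_le y a)
    rw [add_mul, ← Real.exp_add, ← Real.exp_add]
    refine add_le_add (Real.exp_le_exp.2 ?_) (Real.exp_le_exp.2 ?_) <;>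
      simp only [Pi.add_apply] <;> linarith

theorem pow_le_factorial_mul_exp {x : ℝ} (hx : 0 ≤ x) (N : ℕ) :
    x ^ N ≤ N.factorial * Real.exp x := by
  have := Real.pow_div_factorial_le_exp x hx N
  rwa [div_le_iff₀ (by positivity), mul_comm] at this

/-- From x^N ≤ N! e^x with x = 1 + ‖v‖ + ‖y‖. The bound separates the base point from the increment,
so that the increment can be integrated alone. -/
theorem one_add_norm_pow_le (v y : Fin d → ℝ) (N : ℕ) :
    (1 + (‖v‖ + ‖y‖)) ^ N ≤ N.factorial * Real.exp 1 * (expWeight v * Real.exp ‖y‖) := by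
  refine (pow_le_factorial_mul_exp (by positivity) N).trans ?_
  rw [Real.exp_add, Real.exp_add, mul_assoc]
  have := exp_norm_le_expWeight v
  gcongr

theorem PolyBdd.le_expWeight (hM : ∀ i, 0 ≤ M i) {F : ι → (Fin d → ℝ) → ℝ} (h : PolyBdd M F) :
    ∃ C, 0 ≤ C ∧ ∀ i v, |F i v| ≤ C * M i * expWeight v := by
  obtain ⟨C, N, hC, h⟩ := h
  refine ⟨C * (N.factorial * Real.exp 1), by positivity, fun i v => (h i v).trans ?_⟩
  have := one_add_norm_pow_le v 0 N
  simp only [norm_zero, add_zero, Real.exp_zero, mul_one] at this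
  have hi := hM i
  calc C * M i * (1 + ‖v‖) ^ N ≤ C * M i * (N.factorial * Real.exp 1 * expWeight v) := by gcongr
    _ = _ := by ring

theorem PolyBdd.uniform (hM : ∀ i, 0 ≤ M i) {κ : Type*} [Fintype κ]
    {F : κ → ι → (Fin d → ℝ) → ℝ} (h : ∀ k, PolyBdd M (F k)) :
    ∃ (C : ℝ) (N : ℕ), 0 ≤ C ∧ ∀ k i v, |F k i v| ≤ C * M i * (1 + ‖v‖) ^ N := by
  choose C N hC h using h
  refine ⟨∑ k, C k, ∑ k, N k, Finset.sum_nonneg fun k _ => hC k, fun k i v => ?_⟩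
  refine (h k i v).trans ?_
  have h1 : C k ≤ ∑ k, C k := Finset.single_le_sum (fun k _ => hC k) (Finset.mem_univ k)
  have h2 : N k ≤ ∑ k, N k := Finset.single_le_sum (fun k _ => Nat.zero_le _) (Finset.mem_univ k)
  have h3 : (1 : ℝ) ≤ 1 + ‖v‖ := by linarith [norm_nonneg v]
  have hi := hM i
  have h4 : 0 ≤ ∑ k, C k := (hC k).trans h1
  calc C k * M i * (1 + ‖v‖) ^ N k ≤ (∑ k, C k) * M i * (1 + ‖v‖) ^ N k := by gcongr
    _ ≤ _ := mul_le_mul_of_nonneg_left (pow_le_pow_right₀ h3 h2) (mul_nonneg h4 hi)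

end ExpWeight

/-! ### Centred laws with exponential moments. -/

section Laws

variable {d : ℕ}

theorem exp_le_one_add_add (u : ℝ) : Real.exp u ≤ 1 + u + u ^ 2 * Real.exp |u| := by
  have key := abs_sub_taylor_sum_le (m := 2) (K := u ^ 2 * Real.exp |u|)
    (fun k t => u ^ k * Real.exp (t * u)) ?_ ?_ 1 (by simp)
  · simp [Finset.sum_range_succ] at key
    linarith [(abs_le.1 key).2]
  · intro k _ t _
    have := (((hasDerivAt_id t).mul_const u).exp).const_mul (u ^ k)
    convert! this using 1
    simp only [id]
    ring
  · intro t ht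
    rw [abs_mul, abs_of_nonneg (sq_nonneg u), Real.abs_exp]
    gcongr
    calc t * u ≤ |t * u| := le_abs_self _
      _ = t * |u| := by rw [abs_mul, abs_of_nonneg ht.1]
      _ ≤ |u| := by nlinarith [ht.2, abs_nonneg u]

/-- A centred probability measure with exponential moments. -/
structure CentredExp (ν : Measure (Fin d → ℝ)) : Prop where
  prob : IsProbabilityMeasure ν
  integrable : Integrable (fun x => Real.exp (2 * ‖x‖)) ν
  mean : ∀ a, ∫ x, x a ∂ν = 0

/-- The exponential moment `∫ e^{2‖x‖} dν`. -/
noncomputable def expMoment (ν : Measure (Fin d → ℝ)) : ℝ := ∫ x, Real.exp (2 * ‖x‖) ∂ν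

theorem expMoment_nonneg (ν : Measure (Fin d → ℝ)) : 0 ≤ expMoment ν :=
  integral_nonneg fun _ => (Real.exp_pos _).le

variable {ν γ : Measure (Fin d → ℝ)}

theorem CentredExp.integrable_of_le (hν : CentredExp ν) {g : (Fin d → ℝ) → ℝ}
    (hg : Continuous g) (C : ℝ) (h : ∀ x, |g x| ≤ C * Real.exp (2 * ‖x‖)) : Integrable g ν :=
  (hν.integrable.const_mul C).mono' hg.aestronglyMeasurable (Filter.Eventually.of_forall h)

theorem norm_pow_mul_exp_le (x : Fin d → ℝ) (q : ℕ) :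
    ‖x‖ ^ q * Real.exp ‖x‖ ≤ q.factorial * Real.exp (2 * ‖x‖) := by
  have := pow_le_factorial_mul_exp (norm_nonneg x) q
  calc ‖x‖ ^ q * Real.exp ‖x‖ ≤ (q.factorial * Real.exp ‖x‖) * Real.exp ‖x‖ := by gcongr
    _ = _ := by rw [two_mul, Real.exp_add]; ring

theorem norm_pow_le_exp (x : Fin d → ℝ) (q : ℕ) :
    ‖x‖ ^ q ≤ q.factorial * Real.exp (2 * ‖x‖) := by
  refine le_trans ?_ (norm_pow_mul_exp_le x q)
  exact le_mul_of_one_le_right (by positivity) (Real.one_le_exp (norm_nonneg x))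

theorem CentredExp.integrable_coord (hν : CentredExp ν) (a : Fin d) :
    Integrable (fun x => x a) ν :=
  hν.integrable_of_le (by fun_prop) 1 fun x =>
    (abs_coord_le x a).trans (by simpa using norm_pow_le_exp x 1)

theorem CentredExp.integrable_coord_two (hν : CentredExp ν) (a b : Fin d) :
    Integrable (fun x => x a * x b) ν :=
  hν.integrable_of_le (by fun_prop) _ fun x => by
    refine le_trans ?_ (norm_pow_le_exp x 2)
    rw [abs_mul, pow_two]
    gcongr <;> exact abs_coord_le x _

theorem CentredExp.integrable_coord_three (hν : CentredExp ν) (a b c : Fin d) :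
    Integrable (fun x => x a * x b * x c) ν :=
  hν.integrable_of_le (by fun_prop) _ fun x => by
    refine le_trans ?_ (norm_pow_le_exp x 3)
    rw [abs_mul, abs_mul, pow_succ, pow_two]
    gcongr <;> exact abs_coord_le x _

/-- The linear term vanishes by centring. Two centred laws with equal covariances can thus differ
only in the third-moment term. -/
theorem CentredExp.integral_cubic (hν : CentredExp ν) (s c0 : ℝ) (g1 : Fin d → ℝ)
    (g2 : Fin d → Fin d → ℝ) (g3 : Fin d → Fin d → Fin d → ℝ) :
    Integrable (fun x => c0 + ∑ a, (s • x) a * g1 a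
        + (∑ a, ∑ b, (s • x) a * (s • x) b * g2 a b) / 2
        + (∑ a, ∑ b, ∑ c, (s • x) a * (s • x) b * (s • x) c * g3 a b c) / 6) ν ∧
    ∫ x, (c0 + ∑ a, (s • x) a * g1 a
        + (∑ a, ∑ b, (s • x) a * (s • x) b * g2 a b) / 2
        + (∑ a, ∑ b, ∑ c, (s • x) a * (s • x) b * (s • x) c * g3 a b c) / 6) ∂ν
      = c0 + (∑ a, ∑ b, s ^ 2 * (∫ x, x a * x b ∂ν) * g2 a b) / 2
        + (∑ a, ∑ b, ∑ c, s ^ 3 * (∫ x, x a * x b * x c ∂ν) * g3 a b c) / 6 := by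
  have := hν.prob
  have i0 : Integrable (fun _ : Fin d → ℝ => c0) ν := integrable_const _
  have e1 : ∀ a (x : Fin d → ℝ), (s • x) a * g1 a = x a * (s * g1 a) := fun a x => by
    simp only [Pi.smul_apply, smul_eq_mul]; ring
  have e2 : ∀ a b (x : Fin d → ℝ), (s • x) a * (s • x) b * g2 a b
      = x a * x b * (s ^ 2 * g2 a b) := fun a b x => by
    simp only [Pi.smul_apply, smul_eq_mul]; ring
  have e3 : ∀ a b c (x : Fin d → ℝ), (s • x) a * (s • x) b * (s • x) c * g3 a b c
      = x a * x b * x c * (s ^ 3 * g3 a b c) := fun a b c x => by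
    simp only [Pi.smul_apply, smul_eq_mul]; ring
  simp only [e1, e2, e3]
  have i1 : ∀ a, Integrable (fun x => x a * (s * g1 a)) ν :=
    fun a => (hν.integrable_coord a).mul_const _
  have i2 : ∀ a b, Integrable (fun x => x a * x b * (s ^ 2 * g2 a b)) ν :=
    fun a b => (hν.integrable_coord_two a b).mul_const _
  have i3 : ∀ a b c, Integrable (fun x => x a * x b * x c * (s ^ 3 * g3 a b c)) ν :=
    fun a b c => (hν.integrable_coord_three a b c).mul_const _
  have j1 : Integrable (fun x : Fin d → ℝ => ∑ a, x a * (s * g1 a)) ν :=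
    integrable_finsetSum _ fun a _ => i1 a
  have j2' : ∀ a, Integrable (fun x : Fin d → ℝ => ∑ b, x a * x b * (s ^ 2 * g2 a b)) ν :=
    fun a => integrable_finsetSum _ fun b _ => i2 a b
  have j2 : Integrable (fun x : Fin d → ℝ => ∑ a, ∑ b, x a * x b * (s ^ 2 * g2 a b)) ν :=
    integrable_finsetSum _ fun a _ => j2' a
  have j3'' : ∀ a b, Integrable
      (fun x : Fin d → ℝ => ∑ c, x a * x b * x c * (s ^ 3 * g3 a b c)) ν :=
    fun a b => integrable_finsetSum _ fun c _ => i3 a b c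
  have j3' : ∀ a, Integrable
      (fun x : Fin d → ℝ => ∑ b, ∑ c, x a * x b * x c * (s ^ 3 * g3 a b c)) ν :=
    fun a => integrable_finsetSum _ fun b _ => j3'' a b
  have j3 : Integrable
      (fun x : Fin d → ℝ => ∑ a, ∑ b, ∑ c, x a * x b * x c * (s ^ 3 * g3 a b c)) ν :=
    integrable_finsetSum _ fun a _ => j3' a
  have k1 : Integrable (fun x : Fin d → ℝ => c0 + ∑ a, x a * (s * g1 a)) ν := i0.add j1
  have k2 : Integrable (fun x : Fin d → ℝ => c0 + ∑ a, x a * (s * g1 a)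
      + (∑ a, ∑ b, x a * x b * (s ^ 2 * g2 a b)) / 2) ν := k1.add (j2.div_const 2)
  refine ⟨k2.add (j3.div_const 6), ?_⟩
  rw [integral_add k2 (j3.div_const 6), integral_add k1 (j2.div_const 2), integral_add i0 j1, integral_div, integral_div,
    integral_finsetSum _ fun a _ => i1 a, integral_finsetSum _ fun a _ => j2' a,
    integral_finsetSum _ fun a _ => j3' a]
  congr 1
  · congr 1
    · simp [integral_mul_const, hν.mean]
    · congr 1
      refine Finset.sum_congr rfl fun a _ => ?_
      rw [integral_finsetSum _ fun b _ => i2 a b]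
      refine Finset.sum_congr rfl fun b _ => ?_
      rw [integral_mul_const]; ring
  · congr 1
    refine Finset.sum_congr rfl fun a _ => ?_
    rw [integral_finsetSum _ fun b _ => j3'' a b]
    refine Finset.sum_congr rfl fun b _ => ?_
    rw [integral_finsetSum _ fun c _ => i3 a b c]
    refine Finset.sum_congr rfl fun c _ => ?_
    rw [integral_mul_const]; ring

theorem norm_smul_le_of_mem {s : ℝ} (hs : s ∈ Set.Icc (0 : ℝ) 1) (x : Fin d → ℝ) :
    ‖s • x‖ ≤ ‖x‖ := by
  rw [norm_smul, Real.norm_eq_abs, abs_of_nonneg hs.1]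
  nlinarith [norm_nonneg x, hs.2]

/-- Scaling extracts s^q from ‖sx‖^q. One factor e^{‖x‖} comes from the weight and a second absorbs
‖x‖^q, whence the exponent 2‖x‖ in `expMoment`. -/
theorem CentredExp.abs_integral_remainder_le (hν : CentredExp ν) {s : ℝ}
    (hs : s ∈ Set.Icc (0 : ℝ) 1) {R : (Fin d → ℝ) → ℝ} {A : ℝ} (hA : 0 ≤ A) (q : ℕ)
    (h : ∀ y, |R y| ≤ A * (‖y‖ ^ q * Real.exp ‖y‖)) :
    |∫ x, R (s • x) ∂ν| ≤ A * q.factorial * s ^ q * expMoment ν := by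
  have hb : ∀ x, ‖R (s • x)‖ ≤ (A * q.factorial * s ^ q) * Real.exp (2 * ‖x‖) := by
    intro x
    have h1 := h (s • x)
    have h2 : ‖s • x‖ ^ q * Real.exp ‖s • x‖ ≤ s ^ q * (‖x‖ ^ q * Real.exp ‖x‖) := by
      have : ‖s • x‖ = s * ‖x‖ := by rw [norm_smul, Real.norm_eq_abs, abs_of_nonneg hs.1]
      have h3 := norm_smul_le_of_mem hs x
      calc ‖s • x‖ ^ q * Real.exp ‖s • x‖ ≤ ‖s • x‖ ^ q * Real.exp ‖x‖ := by gcongr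
        _ = _ := by rw [this, mul_pow]; ring
    have h3 := norm_pow_mul_exp_le x q
    have hsq : 0 ≤ s ^ q := pow_nonneg hs.1 q
    calc ‖R (s • x)‖ ≤ A * (s ^ q * (q.factorial * Real.exp (2 * ‖x‖))) := by
          rw [Real.norm_eq_abs]
          refine h1.trans (mul_le_mul_of_nonneg_left (h2.trans ?_) hA)
          exact mul_le_mul_of_nonneg_left h3 hsq
      _ = _ := by ring
  have := norm_integral_le_of_norm_le (hν.integrable.const_mul (A * q.factorial * s ^ q))
    (Filter.Eventually.of_forall hb)
  rwa [integral_const_mul] at this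

theorem CentredExp.integrable_exp_smul (hν : CentredExp ν) {s : ℝ} (hs : s ∈ Set.Icc (0 : ℝ) 1)
    {σ : ℝ} (hσ : |σ| ≤ 1) (a : Fin d) : Integrable (fun x => Real.exp (σ * (s • x) a)) ν := by
  refine hν.integrable_of_le (by fun_prop) 1 fun x => ?_
  rw [Real.abs_exp, one_mul]
  refine Real.exp_le_exp.2 ?_
  have h1 := (abs_coord_le (s • x) a).trans (norm_smul_le_of_mem hs x)
  have h2 : |σ * (s • x) a| ≤ 1 * ‖x‖ := by rw [abs_mul]; gcongr
  linarith [(abs_le.1 h2).2, norm_nonneg x]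

theorem CentredExp.integral_exp_le (hν : CentredExp ν) {s : ℝ} (hs : s ∈ Set.Icc (0 : ℝ) 1)
    {σ : ℝ} (hσ : |σ| ≤ 1) (a : Fin d) :
    ∫ x, Real.exp (σ * (s • x) a) ∂ν ≤ 1 + 2 * expMoment ν * s ^ 2 := by
  have := hν.prob
  have hb : ∀ x : Fin d → ℝ, Real.exp (σ * (s • x) a)
      ≤ 1 + (σ * s) * x a + s ^ 2 * 2 * Real.exp (2 * ‖x‖) := by
    intro x
    set u := σ * (s • x) a
    have hu : |u| ≤ s * ‖x‖ := by
      have h1 := abs_coord_le x a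
      have : |u| = |σ| * (s * |x a|) := by
        simp only [u, Pi.smul_apply, smul_eq_mul, abs_mul, abs_of_nonneg hs.1]
      rw [this]
      have h0 : s * |x a| ≤ s * ‖x‖ := mul_le_mul_of_nonneg_left h1 hs.1
      have h00 : 0 ≤ s * |x a| := mul_nonneg hs.1 (abs_nonneg _)
      nlinarith [abs_nonneg σ]
    have hu2 : u ^ 2 ≤ s ^ 2 * ‖x‖ ^ 2 := by
      rw [← mul_pow, ← sq_abs]; exact pow_le_pow_left₀ (abs_nonneg _) hu 2
    have hu3 : |u| ≤ ‖x‖ := hu.trans (by nlinarith [norm_nonneg x, hs.2])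
    have h3 := norm_pow_mul_exp_le x 2
    have h4 : u ^ 2 * Real.exp |u| ≤ s ^ 2 * 2 * Real.exp (2 * ‖x‖) := by
      calc u ^ 2 * Real.exp |u| ≤ (s ^ 2 * ‖x‖ ^ 2) * Real.exp ‖x‖ := by gcongr
        _ = s ^ 2 * (‖x‖ ^ 2 * Real.exp ‖x‖) := by ring
        _ ≤ s ^ 2 * ((2 : ℕ).factorial * Real.exp (2 * ‖x‖)) := by gcongr
        _ = _ := by norm_num [Nat.factorial]; ring
    have h5 := exp_le_one_add_add u
    have h6 : u = (σ * s) * x a := by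
      simp only [u, Pi.smul_apply, smul_eq_mul]; ring
    linarith
  have i1 : Integrable (fun x : Fin d → ℝ => 1 + (σ * s) * x a) ν :=
    (integrable_const _).add ((hν.integrable_coord a).const_mul _)
  have i2 := hν.integrable.const_mul (s ^ 2 * 2)
  calc _ ≤ ∫ x, (1 + (σ * s) * x a + s ^ 2 * 2 * Real.exp (2 * ‖x‖)) ∂ν :=
        integral_mono (hν.integrable_exp_smul hs hσ a) (i1.add i2) hb
    _ = _ := by
        rw [integral_add i1 i2, integral_add (integrable_const _)
          ((hν.integrable_coord a).const_mul _), integral_const_mul, integral_const_mul, hν.mean]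
        simp [expMoment]
        ring

/-- Every exponential in the weight is multiplicative under addition, so an independent increment
multiplies its mean by a moment generating function. That factor is 1 + O(s²) because the increment
is centred; about s^{-2} such factors have a bounded product. -/
theorem CentredExp.integral_expWeight_le (hν : CentredExp ν) {s : ℝ}
    (hs : s ∈ Set.Icc (0 : ℝ) 1) (v : Fin d → ℝ) :
    ∫ x, expWeight (v + s • x) ∂ν ≤ (1 + 2 * expMoment ν * s ^ 2) * expWeight v := by
  have := hν.prob
  have hp : ∀ a, Integrable (fun x => Real.exp ((s • x) a)) ν := fun a => by
    simpa using hν.integrable_exp_smul hs (σ := 1) (by simp) a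
  have hm : ∀ a, Integrable (fun x => Real.exp (-(s • x) a)) ν := fun a => by
    simpa using hν.integrable_exp_smul hs (σ := -1) (by simp) a
  have lp : ∀ a, ∫ x, Real.exp ((s • x) a) ∂ν ≤ 1 + 2 * expMoment ν * s ^ 2 := fun a => by
    simpa only [one_mul] using hν.integral_exp_le hs (σ := 1) (by simp) a
  have lm : ∀ a, ∫ x, Real.exp (-(s • x) a) ∂ν ≤ 1 + 2 * expMoment ν * s ^ 2 := fun a => by
    simpa only [neg_mul, one_mul] using hν.integral_exp_le hs (σ := -1) (by simp) a
  have e : ∀ x, expWeight (v + s • x) = 1 + ∑ a, (Real.exp (v a) * Real.exp ((s • x) a)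
      + Real.exp (-v a) * Real.exp (-(s • x) a)) := by
    intro x
    unfold expWeight
    simp only [← Real.exp_add, Pi.add_apply, neg_add]
  simp only [e]
  have i1 : ∀ a, Integrable (fun x => Real.exp (v a) * Real.exp ((s • x) a)
      + Real.exp (-v a) * Real.exp (-(s • x) a)) ν :=
    fun a => ((hp a).const_mul _).add ((hm a).const_mul _)
  rw [integral_add (integrable_const _) (integrable_finsetSum _ fun a _ => i1 a),
    integral_finsetSum _ fun a _ => i1 a]
  have hK := expMoment_nonneg ν
  have hs2 : 0 ≤ 2 * expMoment ν * s ^ 2 := by positivity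
  unfold expWeight
  rw [mul_add, Finset.mul_sum]
  refine add_le_add (by simpa using hs2) (Finset.sum_le_sum fun a _ => ?_)
  rw [integral_add ((hp a).const_mul _) ((hm a).const_mul _), integral_const_mul,
    integral_const_mul]
  have := mul_le_mul_of_nonneg_left (lp a) (Real.exp_pos (v a)).le
  have := mul_le_mul_of_nonneg_left (lm a) (Real.exp_pos (-v a)).le
  linarith

end Laws

/-! ### A single Lindeberg replacement. -/

section Swap

variable {d : ℕ} {ι : Type*} {M : ι → ℝ} {ν γ : Measure (Fin d → ℝ)}

theorem uReg_succ_iff {m : ℕ} {f : ι → (Fin d → ℝ) → ℝ} :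
    UReg M (m + 1) f ↔ PolyBdd M f ∧ ∃ f' : Fin d → ι → (Fin d → ℝ) → ℝ,
      (∀ i, HasGrad (f i) fun a => f' a i) ∧ ∀ a, UReg M m (f' a) := Iff.rfl

theorem segment_bound {C Mi B : ℝ} (hC : 0 ≤ C * Mi) {N : ℕ} {v y w : Fin d → ℝ}
    (h : B ≤ C * Mi * (1 + ‖w‖) ^ N) (hw : ‖w‖ ≤ ‖v‖ + ‖y‖) :
    B ≤ C * Mi * (N.factorial * Real.exp 1 * (expWeight v * Real.exp ‖y‖)) := by
  refine h.trans (mul_le_mul_of_nonneg_left ?_ hC)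
  refine le_trans ?_ (one_add_norm_pow_le v y N)
  gcongr

theorem CentredExp.integrable_comp_smul (hν : CentredExp ν) (hM : ∀ i, 0 ≤ M i)
    {F : ι → (Fin d → ℝ) → ℝ} (hF : PolyBdd M F) (hc : ∀ i, Continuous (F i)) {s : ℝ}
    (hs : s ∈ Set.Icc (0 : ℝ) 1) (i : ι) (v : Fin d → ℝ) :
    Integrable (fun x => F i (v + s • x)) ν := by
  obtain ⟨C, hC, h⟩ := hF.le_expWeight hM
  refine hν.integrable_of_le ((hc i).comp (by fun_prop)) (C * M i * expWeight v) fun x => ?_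
  refine (h i _).trans ?_
  rw [mul_assoc (C * M i)]
  refine mul_le_mul_of_nonneg_left ((expWeight_add_le v _).trans ?_) (mul_nonneg hC (hM i))
  refine mul_le_mul_of_nonneg_left (Real.exp_le_exp.2 ?_)
    (zero_le_one.trans (one_le_expWeight v))
  linarith [norm_smul_le_of_mem hs x, norm_nonneg x]

/-- Replacing one small centred increment by another with the same covariance changes expectations
by a term of third order. -/
theorem swap_three (hM : ∀ i, 0 ≤ M i) (hν : CentredExp ν) (hγ : CentredExp γ)
    (hcov : ∀ a b, ∫ x, x a * x b ∂ν = ∫ x, x a * x b ∂γ)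
    {F : ι → (Fin d → ℝ) → ℝ} (hF : UReg M 3 F) :
    ∃ C, 0 ≤ C ∧ ∀ i, ∀ s ∈ Set.Icc (0 : ℝ) 1, ∀ v,
      |∫ x, F i (v + s • x) ∂ν - ∫ x, F i (v + s • x) ∂γ| ≤ C * M i * s ^ 3 * expWeight v := by
  have hp0 := hF.polyBdd
  have hc0 := hF.continuous
  obtain ⟨_, f1, g0, r1⟩ := hF
  simp only [uReg_succ_iff] at r1
  choose _ f2 g1 r2 using r1
  choose _ f3 g2 r3 using r2
  obtain ⟨C, N, hC, hb⟩ := PolyBdd.uniform hM (κ := Fin d × Fin d × Fin d)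
    (F := fun k => f3 k.1 k.2.1 k.2.2) fun k => (r3 k.1 k.2.1 k.2.2)
  set D : ℝ := d ^ 3 * (C * (N.factorial * Real.exp 1)) * (Nat.factorial 3)
  refine ⟨D * (expMoment ν + expMoment γ), mul_nonneg (by positivity)
    (add_nonneg (expMoment_nonneg ν) (expMoment_nonneg γ)), fun i s hs v => ?_⟩
  have hi := hM i
  have hψ : 0 ≤ expWeight v := zero_le_one.trans (one_le_expWeight v)
  -- The zero cubic term only serves to fit the shape of `integral_cubic`.
  set P : (Fin d → ℝ) → ℝ := fun y => F i v + ∑ a, y a * f1 a i v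
    + (∑ a, ∑ b, y a * y b * f2 a b i v) / 2
    + (∑ a : Fin d, ∑ b : Fin d, ∑ c : Fin d, y a * y b * y c * 0) / 6 with hP
  set A : ℝ := d ^ 3 * (C * M i * (N.factorial * Real.exp 1 * expWeight v))
  have hA : 0 ≤ A := by positivity
  have hR : ∀ y, |F i (v + y) - P y| ≤ A * (‖y‖ ^ 3 * Real.exp ‖y‖) := by
    intro y
    have := taylor_three (g0 i) (fun a => g1 a i) (fun a b => g2 a b i) v y
      (fun a b c w hw => segment_bound (by positivity) (hb (a, b, c) i w) hw)
    simp only [hP, mul_zero, Finset.sum_const_zero, zero_div, add_zero]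
    refine this.trans (le_of_eq ?_)
    ring
  have key : ∀ {μ : Measure (Fin d → ℝ)} (hμ : CentredExp μ),
      |∫ x, F i (v + s • x) ∂μ - ∫ x, P (s • x) ∂μ| ≤ A * Nat.factorial 3 * s ^ 3 * expMoment μ := by
    intro μ hμ
    rw [← integral_sub (hμ.integrable_comp_smul hM hp0 hc0 hs i v)
      (hμ.integral_cubic s _ _ _ _).1]
    exact hμ.abs_integral_remainder_le hs (R := fun y => F i (v + y) - P y) hA 3 hR
  have e : ∫ x, P (s • x) ∂ν = ∫ x, P (s • x) ∂γ := by
    simp only [hP]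
    rw [(hν.integral_cubic s _ _ _ _).2, (hγ.integral_cubic s _ _ _ _).2]
    simp only [hcov, mul_zero]
  have kν := abs_le.1 (key hν)
  have kγ := abs_le.1 (key hγ)
  have e2 : D * (expMoment ν + expMoment γ) * M i * s ^ 3 * expWeight v
      = A * Nat.factorial 3 * s ^ 3 * expMoment ν + A * Nat.factorial 3 * s ^ 3 * expMoment γ := by
    simp only [D, A]; ring
  rw [e2, abs_le]
  constructor <;> linarith [kν.1, kν.2, kγ.1, kγ.2]

/-- Taylor's formula is pushed one order further than in `swap_three`. The surviving term `G` pairs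
the third partials of `F` with the difference of third moments. Three of the six orders of
regularity remain for `G`, just what the first-order theorem needs, and three differentiations of an
even function make it odd. -/
theorem swap_four (hM : ∀ i, 0 ≤ M i) (hν : CentredExp ν) (hγ : CentredExp γ)
    (hcov : ∀ a b, ∫ x, x a * x b ∂ν = ∫ x, x a * x b ∂γ)
    {F : ι → (Fin d → ℝ) → ℝ} (hF : UReg M 6 F) (heven : ∀ i v, F i (-v) = F i v) :
    ∃ (C : ℝ) (G : ι → (Fin d → ℝ) → ℝ), 0 ≤ C ∧ UReg M 3 G ∧ (∀ i v, G i (-v) = -G i v) ∧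
      ∀ i, ∀ s ∈ Set.Icc (0 : ℝ) 1, ∀ v,
        |∫ x, F i (v + s • x) ∂ν - ∫ x, F i (v + s • x) ∂γ - s ^ 3 * G i v|
          ≤ C * M i * s ^ 4 * expWeight v := by
  have hp0 := hF.polyBdd
  have hc0 := hF.continuous
  obtain ⟨_, f1, g0, r1⟩ := hF
  simp only [uReg_succ_iff (m := 4)] at r1
  choose _ f2 g1 r2 using r1
  simp only [uReg_succ_iff (m := 3)] at r2
  choose _ f3 g2 r3 using r2
  have r3' := r3
  simp only [uReg_succ_iff (m := 2)] at r3'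
  choose _ f4 g3 r4 using r3'
  obtain ⟨C, N, hC, hb⟩ := PolyBdd.uniform hM (κ := Fin d × Fin d × Fin d × Fin d)
    (F := fun k => f4 k.1 k.2.1 k.2.2.1 k.2.2.2) fun k => (r4 k.1 k.2.1 k.2.2.1 k.2.2.2).polyBdd
  set D : ℝ := d ^ 4 * (C * (N.factorial * Real.exp 1)) * (Nat.factorial 4)
  set κ : Fin d → Fin d → Fin d → ℝ := fun a b c =>
    (∫ x, x a * x b * x c ∂ν - ∫ x, x a * x b * x c ∂γ) / 6 with hκ
  refine ⟨D * (expMoment ν + expMoment γ), fun i v => ∑ a, ∑ b, ∑ c, κ a b c * f3 a b c i v,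
    mul_nonneg (by positivity) (add_nonneg (expMoment_nonneg ν) (expMoment_nonneg γ)),
    UReg.sum hM _ fun a _ => UReg.sum hM _ fun b _ => UReg.sum hM _ fun c _ =>
      (r3 a b c).const_mul _, fun i v => ?_, fun i s hs v => ?_⟩
  · have h1 := fun a v => (g0 i).odd_of_even (heven i) a v
    have h2 := fun a b v => (g1 a i).even_of_odd (h1 a) b v
    have h3 := fun a b c v => (g2 a b i).odd_of_even (h2 a b) c v
    simp only [h3, mul_neg, Finset.sum_neg_distrib]
  have hi := hM i
  have hψ : 0 ≤ expWeight v := zero_le_one.trans (one_le_expWeight v)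
  set P : (Fin d → ℝ) → ℝ := fun y => F i v + ∑ a, y a * f1 a i v
    + (∑ a, ∑ b, y a * y b * f2 a b i v) / 2
    + (∑ a, ∑ b, ∑ c, y a * y b * y c * f3 a b c i v) / 6 with hP
  set A : ℝ := d ^ 4 * (C * M i * (N.factorial * Real.exp 1 * expWeight v))
  have hA : 0 ≤ A := by positivity
  have hR : ∀ y, |F i (v + y) - P y| ≤ A * (‖y‖ ^ 4 * Real.exp ‖y‖) := by
    intro y
    have := taylor_four (g0 i) (fun a => g1 a i) (fun a b => g2 a b i) (fun a b c => g3 a b c i) v y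
      (fun a b c e w hw => segment_bound (by positivity) (hb (a, b, c, e) i w) hw)
    refine this.trans (le_of_eq ?_)
    ring
  have key : ∀ {μ : Measure (Fin d → ℝ)} (hμ : CentredExp μ),
      |∫ x, F i (v + s • x) ∂μ - ∫ x, P (s • x) ∂μ| ≤ A * Nat.factorial 4 * s ^ 4 * expMoment μ := by
    intro μ hμ
    rw [← integral_sub (hμ.integrable_comp_smul hM hp0 hc0 hs i v)
      (hμ.integral_cubic s _ _ _ _).1]
    exact hμ.abs_integral_remainder_le hs (R := fun y => F i (v + y) - P y) hA 4 hR
  have e : ∫ x, P (s • x) ∂ν - ∫ x, P (s • x) ∂γ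
      = s ^ 3 * ∑ a, ∑ b, ∑ c, κ a b c * f3 a b c i v := by
    simp only [hP]
    rw [(hν.integral_cubic s _ _ _ _).2, (hγ.integral_cubic s _ _ _ _).2]
    simp only [hcov, add_sub_add_left_eq_sub, ← sub_div, ← Finset.sum_sub_distrib,
      Finset.mul_sum, Finset.sum_div]
    refine Finset.sum_congr rfl fun a _ => Finset.sum_congr rfl fun b _ =>
      Finset.sum_congr rfl fun c _ => ?_
    simp only [hκ]
    ring
  have kν := abs_le.1 (key hν)
  have kγ := abs_le.1 (key hγ)
  have e2 : D * (expMoment ν + expMoment γ) * M i * s ^ 4 * expWeight v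
      = A * Nat.factorial 4 * s ^ 4 * expMoment ν + A * Nat.factorial 4 * s ^ 4 * expMoment γ := by
    simp only [D, A]; ring
  rw [e2, abs_le]
  constructor <;> linarith [kν.1, kν.2, kγ.1, kγ.2]

end Swap

/-! ### Lindeberg telescoping through mixed sums. -/

section Mixtures

variable {d : ℕ} {ι : Type*} {M : ι → ℝ} {ν γ ρ : Measure (Fin d → ℝ)}

/-- The law of `s x` for `x` of law `ν`. -/
noncomputable def scaleLaw (s : ℝ) (ν : Measure (Fin d → ℝ)) : Measure (Fin d → ℝ) :=
  ν.map fun x => s • x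

theorem isProbabilityMeasure_scaleLaw (s : ℝ) [IsProbabilityMeasure ν] :
    IsProbabilityMeasure (scaleLaw s ν) :=
  Measure.isProbabilityMeasure_map (by fun_prop)

theorem integral_scaleLaw {g : (Fin d → ℝ) → ℝ} (hg : Continuous g) (s : ℝ) (v : Fin d → ℝ) :
    ∫ y, g (v + y) ∂(scaleLaw s ν) = ∫ x, g (v + s • x) ∂ν := by
  have h : Continuous fun y => g (v + y) := hg.comp (continuous_const.add continuous_id)
  unfold scaleLaw
  exact integral_map (by fun_prop) h.aestronglyMeasurable

/-- A probability measure with `∫ expWeight ≤ L`. -/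
structure WeightBdd (ρ : Measure (Fin d → ℝ)) (L : ℝ) : Prop where
  prob : IsProbabilityMeasure ρ
  integrable : Integrable expWeight ρ
  le : ∫ v, expWeight v ∂ρ ≤ L

theorem WeightBdd.integrable_of_le {L : ℝ} (hρ : WeightBdd ρ L) {g : (Fin d → ℝ) → ℝ}
    (hg : Continuous g) {C : ℝ} (h : ∀ x, |g x| ≤ C * expWeight x) : Integrable g ρ :=
  (hρ.integrable.const_mul C).mono' hg.aestronglyMeasurable (Filter.Eventually.of_forall h)

theorem WeightBdd.integrable_polyBdd {L : ℝ} (hρ : WeightBdd ρ L) (hM : ∀ i, 0 ≤ M i)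
    {F : ι → (Fin d → ℝ) → ℝ} (hF : PolyBdd M F) (hc : ∀ i, Continuous (F i)) (i : ι) :
    Integrable (F i) ρ := by
  obtain ⟨C, _, h⟩ := hF.le_expWeight hM
  exact hρ.integrable_of_le (hc i) (h i)

theorem WeightBdd.abs_integral_le {L : ℝ} (hρ : WeightBdd ρ L) {g : (Fin d → ℝ) → ℝ} {C : ℝ}
    (hC : 0 ≤ C) (h : ∀ x, |g x| ≤ C * expWeight x) : |∫ x, g x ∂ρ| ≤ C * L := by
  have := norm_integral_le_of_norm_le (f := g) (hρ.integrable.const_mul C)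
    (Filter.Eventually.of_forall h)
  rw [integral_const_mul] at this
  exact this.trans (mul_le_mul_of_nonneg_left hρ.le hC)

theorem weightBdd_dirac : WeightBdd (Measure.dirac (0 : Fin d → ℝ)) (expWeight (0 : Fin d → ℝ)) where
  prob := inferInstance
  integrable := integrable_dirac (by simp)
  le := by simp

theorem WeightBdd.conv {L : ℝ} (hρ : WeightBdd ρ L) (hν : CentredExp ν) {s : ℝ}
    (hs : s ∈ Set.Icc (0 : ℝ) 1) :
    WeightBdd (ρ ∗ scaleLaw s ν) (Real.exp (2 * expMoment ν * s ^ 2) * L) := by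
  have := hν.prob
  have := hρ.prob
  have := isProbabilityMeasure_scaleLaw (ν := ν) s
  have hint : Integrable expWeight (ρ ∗ scaleLaw s ν) := by
    unfold Measure.conv
    rw [integrable_map_measure continuous_expWeight.aestronglyMeasurable (by fun_prop)]
    have h1 : Integrable (fun y : Fin d → ℝ => Real.exp ‖y‖) (scaleLaw s ν) := by
      unfold scaleLaw
      rw [integrable_map_measure (by fun_prop) (by fun_prop)]
      refine hν.integrable_of_le (by fun_prop) 1 fun x => ?_
      simp only [Function.comp, Real.abs_exp, one_mul]
      refine Real.exp_le_exp.2 ?_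
      linarith [norm_smul_le_of_mem hs x, norm_nonneg x]
    refine (hρ.integrable.mul_prod h1).mono'
      (continuous_expWeight.comp continuous_add).aestronglyMeasurable
      (Filter.Eventually.of_forall fun z => ?_)
    rw [Real.norm_eq_abs]
    simp only [Function.comp]
    rw [abs_of_nonneg (zero_le_one.trans (one_le_expWeight _))]
    exact expWeight_add_le z.1 z.2
  refine ⟨inferInstance, hint, ?_⟩
  rw [integral_conv hint]
  have hK := expMoment_nonneg ν
  have hb : ∀ v, ∫ y, expWeight (v + y) ∂(scaleLaw s ν)
      ≤ (1 + 2 * expMoment ν * s ^ 2) * expWeight v := by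
    intro v
    rw [integral_scaleLaw continuous_expWeight]
    exact hν.integral_expWeight_le hs v
  calc ∫ v, ∫ y, expWeight (v + y) ∂(scaleLaw s ν) ∂ρ
      ≤ ∫ v, (1 + 2 * expMoment ν * s ^ 2) * expWeight v ∂ρ := by
        refine integral_mono_of_nonneg (Filter.Eventually.of_forall fun v =>
          integral_nonneg fun y => zero_le_one.trans (one_le_expWeight _))
          (hρ.integrable.const_mul _) (Filter.Eventually.of_forall hb)
    _ = (1 + 2 * expMoment ν * s ^ 2) * ∫ v, expWeight v ∂ρ := integral_const_mul _ _
    _ ≤ Real.exp (2 * expMoment ν * s ^ 2) * L := by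
        have h1 := Real.add_one_le_exp (2 * expMoment ν * s ^ 2)
        have h2 : 0 ≤ ∫ v, expWeight v ∂ρ :=
          integral_nonneg fun y => zero_le_one.trans (one_le_expWeight _)
        have := hρ.le
        gcongr
        linarith

/-- The law of a sum of `k` independent variables of law `s ν` and `l` of law `s γ`. -/
noncomputable def mixLaw (ν γ : Measure (Fin d → ℝ)) (s : ℝ) : ℕ → ℕ → Measure (Fin d → ℝ)
  | 0, 0 => Measure.dirac 0
  | 0, l + 1 => mixLaw ν γ s 0 l ∗ scaleLaw s γ
  | k + 1, l => mixLaw ν γ s k l ∗ scaleLaw s ν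

theorem mixLaw_weightBdd (hν : CentredExp ν) (hγ : CentredExp γ) {s : ℝ}
    (hs : s ∈ Set.Icc (0 : ℝ) 1) (k l : ℕ) :
    WeightBdd (mixLaw ν γ s k l)
      (Real.exp (2 * (expMoment ν + expMoment γ) * s ^ 2 * (k + l : ℕ))
        * expWeight (0 : Fin d → ℝ)) := by
  have hψ := zero_le_one.trans (one_le_expWeight (0 : Fin d → ℝ))
  have a1 := mul_nonneg (expMoment_nonneg ν) (sq_nonneg s)
  have a2 := mul_nonneg (expMoment_nonneg γ) (sq_nonneg s)
  have step : ∀ {μ ρ : Measure (Fin d → ℝ)} (_ : CentredExp μ) (m : ℕ),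
      expMoment μ * s ^ 2 ≤ expMoment ν * s ^ 2 + expMoment γ * s ^ 2 →
      WeightBdd ρ (Real.exp (2 * (expMoment ν + expMoment γ) * s ^ 2 * (m : ℕ))
        * expWeight (0 : Fin d → ℝ)) →
      WeightBdd (ρ ∗ scaleLaw s μ)
        (Real.exp (2 * (expMoment ν + expMoment γ) * s ^ 2 * (m + 1 : ℕ))
        * expWeight (0 : Fin d → ℝ)) := by
    intro μ ρ hμ m hle hρ
    have h := hρ.conv hμ hs
    refine ⟨h.prob, h.integrable, h.le.trans ?_⟩
    rw [← mul_assoc, ← Real.exp_add]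
    refine mul_le_mul_of_nonneg_right (Real.exp_le_exp.2 ?_) hψ
    push_cast
    nlinarith
  induction k with
  | zero =>
    induction l with
    | zero => simpa [mixLaw] using weightBdd_dirac
    | succ l ih =>
      have := step hγ (0 + l) (by linarith) ih
      simpa only [mixLaw, add_assoc] using this
  | succ k ih =>
    have := step hν (k + l) (by linarith) ih
    rw [mixLaw, show k + 1 + l = k + l + 1 by ring]
    exact this

theorem conv_right_comm (ρ μ₁ μ₂ : Measure (Fin d → ℝ)) [SFinite ρ] [SFinite μ₁] [SFinite μ₂] :
    (ρ ∗ μ₁) ∗ μ₂ = (ρ ∗ μ₂) ∗ μ₁ := by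
  rw [Measure.conv_assoc, Measure.conv_comm μ₁, ← Measure.conv_assoc]

/-- Commutativity of convolution lets a `γ`-summand be split off last even after `ν`-summands.
Neighbouring mixtures then become increments of one common law, as a replacement requires. -/
theorem mixLaw_succ_right (hν : CentredExp ν) (hγ : CentredExp γ) {s : ℝ}
    (hs : s ∈ Set.Icc (0 : ℝ) 1) (k l : ℕ) :
    mixLaw ν γ s k (l + 1) = mixLaw ν γ s k l ∗ scaleLaw s γ := by
  have := hν.prob
  have := hγ.prob
  induction k with
  | zero => rw [mixLaw]
  | succ k ih =>
    have := (mixLaw_weightBdd hν hγ hs k l).prob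
    have := isProbabilityMeasure_scaleLaw (ν := ν) s
    have := isProbabilityMeasure_scaleLaw (ν := γ) s
    rw [mixLaw, ih, mixLaw, conv_right_comm]

theorem integral_mixLaw_succ_left (hM : ∀ i, 0 ≤ M i) (hν : CentredExp ν) (hγ : CentredExp γ)
    {s : ℝ} (hs : s ∈ Set.Icc (0 : ℝ) 1) {F : ι → (Fin d → ℝ) → ℝ} (hF : PolyBdd M F)
    (hc : ∀ i, Continuous (F i)) (k l : ℕ) (i : ι) :
    Integrable (fun v => ∫ x, F i (v + s • x) ∂ν) (mixLaw ν γ s k l) ∧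
    ∫ v, F i v ∂(mixLaw ν γ s (k + 1) l) = ∫ v, ∫ x, F i (v + s • x) ∂ν ∂(mixLaw ν γ s k l) := by
  have := hν.prob
  have := (mixLaw_weightBdd hν hγ hs k l).prob
  have := isProbabilityMeasure_scaleLaw (ν := ν) s
  have hint := (mixLaw_weightBdd hν hγ hs (k + 1) l).integrable_polyBdd hM hF hc i
  rw [mixLaw] at hint
  have e : ∀ v, ∫ y, F i (v + y) ∂(scaleLaw s ν) = ∫ x, F i (v + s • x) ∂ν := integral_scaleLaw (hc i) s
  constructor
  · have := ((integrable_map_measure (hc i).aestronglyMeasurable (by fun_prop)).1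
      hint).integral_prod_left
    simpa only [Function.comp, e] using this
  · rw [mixLaw, integral_conv hint]
    simp only [e]

theorem integral_mixLaw_succ_right (hM : ∀ i, 0 ≤ M i) (hν : CentredExp ν) (hγ : CentredExp γ)
    {s : ℝ} (hs : s ∈ Set.Icc (0 : ℝ) 1) {F : ι → (Fin d → ℝ) → ℝ} (hF : PolyBdd M F)
    (hc : ∀ i, Continuous (F i)) (k l : ℕ) (i : ι) :
    Integrable (fun v => ∫ x, F i (v + s • x) ∂γ) (mixLaw ν γ s k l) ∧
    ∫ v, F i v ∂(mixLaw ν γ s k (l + 1)) = ∫ v, ∫ x, F i (v + s • x) ∂γ ∂(mixLaw ν γ s k l) := by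
  have := hγ.prob
  have := (mixLaw_weightBdd hν hγ hs k l).prob
  have := isProbabilityMeasure_scaleLaw (ν := γ) s
  have hint := (mixLaw_weightBdd hν hγ hs k (l + 1)).integrable_polyBdd hM hF hc i
  rw [mixLaw_succ_right hν hγ hs] at hint
  have e : ∀ v, ∫ y, F i (v + y) ∂(scaleLaw s γ) = ∫ x, F i (v + s • x) ∂γ := integral_scaleLaw (hc i) s
  constructor
  · have := ((integrable_map_measure (hc i).aestronglyMeasurable (by fun_prop)).1
      hint).integral_prod_left
    simpa only [Function.comp, e] using this
  · rw [mixLaw_succ_right hν hγ hs, integral_conv hint]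
    simp only [e]

theorem mixLaw_weightBdd_uniform (hν : CentredExp ν) (hγ : CentredExp γ) :
    ∃ L, 0 ≤ L ∧ ∀ s ∈ Set.Icc (0 : ℝ) 1, ∀ k l : ℕ, s ^ 2 * (k + l : ℕ) ≤ 1 →
      WeightBdd (mixLaw ν γ s k l) L := by
  have hψ := zero_le_one.trans (one_le_expWeight (0 : Fin d → ℝ))
  have h0 := expMoment_nonneg ν
  have h1 := expMoment_nonneg γ
  refine ⟨Real.exp (2 * (expMoment ν + expMoment γ)) * expWeight (0 : Fin d → ℝ),
    by positivity, fun s hs k l hkl => ?_⟩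
  have h := mixLaw_weightBdd hν hγ hs k l
  refine ⟨h.prob, h.integrable, h.le.trans ?_⟩
  refine mul_le_mul_of_nonneg_right (Real.exp_le_exp.2 ?_) hψ
  rw [mul_assoc]
  exact mul_le_of_le_one_right (by positivity) hkl

/-- Rate `s = n^{-1/2}` in the central limit theorem for smooth functions. -/
theorem clt_first_order (hM : ∀ i, 0 ≤ M i) (hν : CentredExp ν) (hγ : CentredExp γ)
    (hcov : ∀ a b, ∫ x, x a * x b ∂ν = ∫ x, x a * x b ∂γ)
    {F : ι → (Fin d → ℝ) → ℝ} (hF : UReg M 3 F) :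
    ∃ C, 0 ≤ C ∧ ∀ i, ∀ s ∈ Set.Icc (0 : ℝ) 1, ∀ k l : ℕ, s ^ 2 * (k + l : ℕ) ≤ 1 →
      |∫ v, F i v ∂(mixLaw ν γ s k l) - ∫ v, F i v ∂(mixLaw ν γ s 0 (k + l))| ≤ C * M i * s := by
  obtain ⟨C, hC, hsw⟩ := swap_three hM hν hγ hcov hF
  obtain ⟨L, hL, hw⟩ := mixLaw_weightBdd_uniform hν hγ
  have hp := hF.polyBdd
  have hc := hF.continuous
  refine ⟨C * L, by positivity, fun i s hs => ?_⟩
  have hi := hM i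
  have hs0 := hs.1
  -- Each of the k replacements costs s³, and s²k ≤ 1 leaves a single factor s.
  suffices h : ∀ k l : ℕ, s ^ 2 * (k + l : ℕ) ≤ 1 →
      |∫ v, F i v ∂(mixLaw ν γ s k l) - ∫ v, F i v ∂(mixLaw ν γ s 0 (k + l))|
        ≤ k * (C * M i * s ^ 3 * L) by
    intro k l hkl
    refine (h k l hkl).trans ?_
    have h1 : s ^ 2 * k ≤ 1 := by
      refine le_trans ?_ hkl
      gcongr
      omega
    calc k * (C * M i * s ^ 3 * L) = (C * L * M i * s) * (s ^ 2 * k) := by ring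
      _ ≤ C * L * M i * s := mul_le_of_le_one_right (by positivity) h1
  intro k
  induction k with
  | zero => intro l _; simp
  | succ k ih =>
    intro l hkl
    have h1 := ih (l + 1) (by rwa [show k + (l + 1) = k + 1 + l by ring])
    have hw1 := hw s hs k l (le_trans (by gcongr; omega) hkl)
    obtain ⟨i1, e1⟩ := integral_mixLaw_succ_left hM hν hγ hs hp hc k l i
    obtain ⟨i2, e2⟩ := integral_mixLaw_succ_right hM hν hγ hs hp hc k l i
    have h2 : |∫ v, F i v ∂(mixLaw ν γ s (k + 1) l) - ∫ v, F i v ∂(mixLaw ν γ s k (l + 1))|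
        ≤ C * M i * s ^ 3 * L := by
      rw [e1, e2, ← integral_sub i1 i2]
      exact hw1.abs_integral_le (by positivity) (hsw i s hs)
    rw [show k + (l + 1) = k + 1 + l by ring] at h1
    have := (abs_sub_le _ _ _).trans (add_le_add h2 h1)
    refine this.trans (le_of_eq ?_)
    push_cast
    ring

/-- For even functions and a symmetric comparison law, the rate improves to `s ^ 2`. -/
theorem clt_second_order (hM : ∀ i, 0 ≤ M i) (hν : CentredExp ν) (hγ : CentredExp γ)
    (hcov : ∀ a b, ∫ x, x a * x b ∂ν = ∫ x, x a * x b ∂γ)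
    (hsymm : ∀ (g : (Fin d → ℝ) → ℝ), Continuous g → (∀ v, g (-v) = -g v) → ∀ s l,
      ∫ v, g v ∂(mixLaw ν γ s 0 l) = 0)
    {F : ι → (Fin d → ℝ) → ℝ} (hF : UReg M 6 F) (heven : ∀ i v, F i (-v) = F i v) :
    ∃ C, 0 ≤ C ∧ ∀ i, ∀ s ∈ Set.Icc (0 : ℝ) 1, ∀ k l : ℕ, s ^ 2 * (k + l : ℕ) ≤ 1 →
      |∫ v, F i v ∂(mixLaw ν γ s k l) - ∫ v, F i v ∂(mixLaw ν γ s 0 (k + l))|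
        ≤ C * M i * s ^ 2 := by
  obtain ⟨C, G, hC, hG, hodd, hsw⟩ := swap_four hM hν hγ hcov hF heven
  obtain ⟨C', hC', hclt⟩ := clt_first_order hM hν hγ hcov hG
  obtain ⟨L, hL, hw⟩ := mixLaw_weightBdd_uniform hν hγ
  have hp := hF.polyBdd
  have hc := hF.continuous
  refine ⟨C * L + C', by positivity, fun i s hs => ?_⟩
  have hi := hM i
  have hs0 := hs.1
  suffices h : ∀ k l : ℕ, s ^ 2 * (k + l : ℕ) ≤ 1 →
      |∫ v, F i v ∂(mixLaw ν γ s k l) - ∫ v, F i v ∂(mixLaw ν γ s 0 (k + l))|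
        ≤ k * ((C * L + C') * M i * s ^ 4) by
    intro k l hkl
    refine (h k l hkl).trans ?_
    have h1 : s ^ 2 * k ≤ 1 := by
      refine le_trans ?_ hkl
      gcongr
      omega
    calc k * ((C * L + C') * M i * s ^ 4) = ((C * L + C') * M i * s ^ 2) * (s ^ 2 * k) := by ring
      _ ≤ (C * L + C') * M i * s ^ 2 := mul_le_of_le_one_right (by positivity) h1
  intro k
  induction k with
  | zero => intro l _; simp
  | succ k ih =>
    intro l hkl
    have h1 := ih (l + 1) (by rwa [show k + (l + 1) = k + 1 + l by ring])
    have hkl' : s ^ 2 * (k + l : ℕ) ≤ 1 := le_trans (by gcongr; omega) hkl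
    have hw1 := hw s hs k l hkl'
    obtain ⟨i1, e1⟩ := integral_mixLaw_succ_left hM hν hγ hs hp hc k l i
    obtain ⟨i2, e2⟩ := integral_mixLaw_succ_right hM hν hγ hs hp hc k l i
    have i3 : Integrable (fun v => s ^ 3 * G i v) (mixLaw ν γ s k l) :=
      (hw1.integrable_polyBdd hM hG.polyBdd hG.continuous i).const_mul _
    -- The mean of the odd function `G` is zero under the all-`γ` law, hence O(s) under the mixture.
    -- Its contribution s³ · O(s) has the order of the Taylor remainder.
    have hG0 := hclt i s hs k l hkl'
    rw [hsymm (G i) (hG.continuous i) (hodd i), sub_zero] at hG0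
    have i12 : Integrable (fun v => ∫ x, F i (v + s • x) ∂ν - ∫ x, F i (v + s • x) ∂γ)
      (mixLaw ν γ s k l) := i1.sub i2
    have h2 : |∫ v, F i v ∂(mixLaw ν γ s (k + 1) l) - ∫ v, F i v ∂(mixLaw ν γ s k (l + 1))
        - s ^ 3 * ∫ v, G i v ∂(mixLaw ν γ s k l)| ≤ C * M i * s ^ 4 * L := by
      rw [e1, e2, ← integral_sub i1 i2, ← integral_const_mul,
        ← integral_sub i12 i3]
      exact hw1.abs_integral_le (by positivity) (hsw i s hs)
    have h3 : |s ^ 3 * ∫ v, G i v ∂(mixLaw ν γ s k l)| ≤ C' * M i * s ^ 4 := by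
      rw [abs_mul, abs_of_nonneg (pow_nonneg hs0 3)]
      calc _ ≤ s ^ 3 * (C' * M i * s) := by gcongr
        _ = _ := by ring
    rw [show k + (l + 1) = k + 1 + l by ring] at h1
    push_cast
    have := abs_le.1 h1
    have := abs_le.1 h2
    have := abs_le.1 h3
    rw [abs_le]
    constructor <;> linarith

end Mixtures

/-! ### The Gaussian comparison law. -/

section Gaussian

/-- The standard Gaussian measure on `Fin d → ℝ`. -/
noncomputable def gaussPi (d : ℕ) : Measure (Fin d → ℝ) :=
  Measure.pi fun _ : Fin d => gaussianReal 0 1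

variable {d : ℕ}

instance isProbabilityMeasure_gaussPi : IsProbabilityMeasure (gaussPi d) := by
  unfold gaussPi
  infer_instance

theorem measurePreserving_eval_gaussPi (a : Fin d) :
    MeasurePreserving (fun x : Fin d → ℝ => x a) (gaussPi d) (gaussianReal 0 1) :=
  measurePreserving_eval (fun _ : Fin d => gaussianReal 0 1) a

theorem integrable_eval_gaussPi (a : Fin d) {g : ℝ → ℝ} (hg : Integrable g (gaussianReal 0 1)) :
    Integrable (fun x => g (x a)) (gaussPi d) :=
  (measurePreserving_eval_gaussPi a).integrable_comp_of_integrable hg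

theorem integral_eval_gaussPi (a : Fin d) {g : ℝ → ℝ} (hg : Continuous g) :
    ∫ x, g (x a) ∂(gaussPi d) = ∫ t, g t ∂(gaussianReal 0 1) := by
  rw [← (measurePreserving_eval_gaussPi a).map_eq, integral_map
    (measurable_pi_apply a).aemeasurable hg.aestronglyMeasurable]

theorem integrable_exp_two_norm_gaussPi :
    Integrable (fun x => Real.exp (2 * ‖x‖)) (gaussPi d) := by
  have h : Integrable (fun x : Fin d → ℝ => expWeight ((2 : ℝ) • x)) (gaussPi d) := by
    unfold expWeight
    refine (integrable_const _).add (integrable_finsetSum _ fun a _ => Integrable.add ?_ ?_)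
    · exact integrable_eval_gaussPi a (g := fun t => Real.exp (2 * t))
        (integrable_exp_mul_gaussianReal 2)
    · simpa using integrable_eval_gaussPi a (g := fun t => Real.exp (-2 * t))
        (integrable_exp_mul_gaussianReal (-2))
  refine h.mono' (by fun_prop) (Filter.Eventually.of_forall fun x => ?_)
  rw [Real.norm_eq_abs, Real.abs_exp]
  convert exp_norm_le_expWeight ((2 : ℝ) • x) using 2
  rw [norm_smul]
  simp

theorem centredExp_gaussPi : CentredExp (gaussPi d) where
  prob := inferInstance
  integrable := integrable_exp_two_norm_gaussPi
  mean a := by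
    rw [integral_eval_gaussPi a (g := fun t => t) continuous_id]
    exact integral_id_gaussianReal

theorem integral_sq_gaussianReal : ∫ t, t ^ 2 ∂(gaussianReal 0 1) = 1 := by
  have h := variance_fun_id_gaussianReal (μ := 0) (v := 1)
  rw [variance_eq_integral (by fun_prop), integral_id_gaussianReal] at h
  simpa using h

theorem cov_gaussPi (a b : Fin d) :
    ∫ x, x a * x b ∂(gaussPi d) = if a = b then 1 else 0 := by
  split_ifs with hab
  · subst hab
    have := integral_eval_gaussPi a (g := fun t => t ^ 2) (by fun_prop)
    simp only [integral_sq_gaussianReal] at this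
    simpa only [pow_two] using this
  · have hind : iIndepFun (fun (i : Fin d) (x : Fin d → ℝ) => x i) (gaussPi d) :=
      iIndepFun_pi (μ := fun _ : Fin d => gaussianReal 0 1) (X := fun _ x => x)
        (fun _ => aemeasurable_id)
    have := (hind.indepFun hab).integral_fun_mul_eq_mul_integral
      (measurable_pi_apply a).aestronglyMeasurable (measurable_pi_apply b).aestronglyMeasurable
    rw [this, centredExp_gaussPi.mean a, zero_mul]

theorem charFunDual_scaleLaw_gaussPi (s : ℝ) (L : StrongDual ℝ (Fin d → ℝ)) :
    charFunDual (scaleLaw s (gaussPi d)) L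
      = Complex.exp (-(s ^ 2 * ∑ a, L (Pi.single a 1) ^ 2 : ℝ) / 2) := by
  have h1 : charFunDual (scaleLaw s (gaussPi d)) L = charFunDual (gaussPi d) (s • L) := by
    rw [charFunDual_apply, charFunDual_apply]
    unfold scaleLaw
    rw [integral_map (by fun_prop) (by fun_prop)]
    simp
  have h2 : ∀ L' : StrongDual ℝ ℝ, charFunDual (gaussianReal 0 1) L'
      = Complex.exp (-(L' 1 ^ 2 : ℝ) / 2) := by
    intro L'
    have : charFunDual (gaussianReal 0 1) L' = charFun (gaussianReal 0 1) (L' 1) := by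
      rw [charFunDual_apply, charFun_apply_real]
      congr 1
      funext t
      have : L' t = L' 1 * t := by
        have := L'.map_smul t (1 : ℝ)
        simp only [smul_eq_mul, mul_one] at this
        rw [this, mul_comm]
      rw [this]
      push_cast
      rfl
    rw [this, charFun_gaussianReal]
    congr 1
    simp
    ring
  rw [h1]
  unfold gaussPi
  rw [charFunDual_pi]
  simp only [h2]
  rw [← Complex.exp_sum]
  congr 1
  push_cast
  simp only [Finset.mul_sum, Finset.sum_div, ← Finset.sum_neg_distrib]
  refine Finset.sum_congr rfl fun a _ => ?_
  simp
  ring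

theorem scaleLaw_gaussPi_conv (s t u : ℝ) (h : s ^ 2 + t ^ 2 = u ^ 2) :
    scaleLaw s (gaussPi d) ∗ scaleLaw t (gaussPi d) = scaleLaw u (gaussPi d) := by
  have := isProbabilityMeasure_scaleLaw (ν := gaussPi d) s
  have := isProbabilityMeasure_scaleLaw (ν := gaussPi d) t
  have := isProbabilityMeasure_scaleLaw (ν := gaussPi d) u
  refine Measure.ext_of_charFunDual (funext fun L => ?_)
  rw [charFunDual_conv]
  simp only [charFunDual_scaleLaw_gaussPi]
  rw [← Complex.exp_add, ← h]
  congr 1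
  push_cast
  ring

/-- Variances of independent Gaussians add, so the all-Gaussian end of the telescope is Gaussian for
every number of summands, not merely in the limit. -/
theorem mixLaw_gaussPi (ν : Measure (Fin d → ℝ)) (s : ℝ) (l : ℕ) :
    mixLaw ν (gaussPi d) s 0 l = scaleLaw (Real.sqrt l * s) (gaussPi d) := by
  induction l with
  | zero =>
    simp [mixLaw, scaleLaw]
  | succ l ih =>
    rw [mixLaw, ih]
    refine scaleLaw_gaussPi_conv _ _ _ ?_
    rw [mul_pow, mul_pow, Real.sq_sqrt (by positivity), Real.sq_sqrt (by positivity)]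
    push_cast
    ring

theorem gaussPi_map_neg : (gaussPi d).map (fun x => -x) = gaussPi d := by
  unfold gaussPi
  have h : ∀ _ : Fin d, (gaussianReal 0 1).map (fun x => -x) = gaussianReal 0 1 := fun _ => by
    rw [gaussianReal_map_neg, neg_zero]
  have : ∀ i : Fin d, SigmaFinite ((gaussianReal 0 1).map (fun x => -x)) := fun i => by
    rw [h i]; infer_instance
  have := Measure.pi_map_pi (μ := fun _ : Fin d => gaussianReal 0 1) (f := fun _ x => -x)
    (fun _ => by fun_prop)
  rw [show (fun i : Fin d => (gaussianReal 0 1).map (fun x => -x)) = fun _ => gaussianReal 0 1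
    from funext h] at this
  exact this

theorem integral_odd_gaussPi (g : (Fin d → ℝ) → ℝ) (hg : ∀ v, g (-v) = -g v) :
    ∫ v, g v ∂(gaussPi d) = 0 := by
  have h : ∫ v, g v ∂(gaussPi d) = ∫ v, g (-v) ∂(gaussPi d) := by
    conv_lhs => rw [← gaussPi_map_neg]
    exact (MeasurableEquiv.neg (Fin d → ℝ)).measurableEmbedding.integral_map g
  simp only [hg, integral_neg] at h
  linarith

theorem integral_odd_scaleLaw_gaussPi (s : ℝ) {g : (Fin d → ℝ) → ℝ} (hc : Continuous g)
    (hg : ∀ v, g (-v) = -g v) : ∫ v, g v ∂(scaleLaw s (gaussPi d)) = 0 := by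
  unfold scaleLaw
  rw [integral_map (by fun_prop) hc.aestronglyMeasurable]
  exact integral_odd_gaussPi _ fun v => by rw [smul_neg, hg]

end Gaussian

/-! ### Test functions on the half-line. -/

section TestFunctions

theorem MemCb.abs_le_derivNorm {m : ℕ} {h : ℝ → ℝ} (hh : MemCb m h) {k : ℕ} (h1 : 1 ≤ k)
    (hk : k ≤ m) {x : ℝ} (hx : 0 ≤ x) :
    |iteratedDerivWithin k h halfLine x| ≤ derivNorm h k := by
  obtain ⟨K, hK⟩ := hh.bounded k h1 hk
  exact le_ciSup (f := fun x : halfLine => |iteratedDerivWithin k h halfLine x|)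
    ⟨K, by rintro _ ⟨y, rfl⟩; exact hK y y.2⟩ ⟨x, hx⟩

theorem derivNorm_nonneg (h : ℝ → ℝ) (k : ℕ) : 0 ≤ derivNorm h k :=
  Real.iSup_nonneg fun _ => abs_nonneg _

theorem hNorm_nonneg (m : ℕ) (h : ℝ → ℝ) : 0 ≤ hNorm m h :=
  Finset.sum_nonneg fun k _ => mul_nonneg (Nat.cast_nonneg _) (derivNorm_nonneg h k)

theorem hTildeNorm_nonneg (m : ℕ) (h : ℝ → ℝ) : 0 ≤ hTildeNorm m h :=
  Finset.sum_nonneg fun k _ => mul_nonneg (Nat.cast_nonneg _)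
    (add_nonneg (mul_nonneg (by positivity) (derivNorm_nonneg h k)) (derivNorm_nonneg h (k + 1)))

/-- The Stirling numbers involved are at least 1 and all summands are nonnegative. -/
theorem derivNorm_le_hNorm_six (h : ℝ → ℝ) {k : ℕ} (h1 : 1 ≤ k) (h6 : k ≤ 6) :
    derivNorm h k ≤ hNorm 6 h := by
  have hS : (1 : ℝ) ≤ (Nat.stirlingSecond 6 k : ℝ) := by
    have : 1 ≤ Nat.stirlingSecond 6 k := by interval_cases k <;> simp [Nat.stirlingSecond]
    exact_mod_cast this
  refine le_trans (le_mul_of_one_le_left (derivNorm_nonneg h k) hS) ?_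
  exact Finset.single_le_sum
    (f := fun k => (Nat.stirlingSecond 6 k : ℝ) * derivNorm h k)
    (fun k _ => mul_nonneg (Nat.cast_nonneg _) (derivNorm_nonneg h k))
    (Finset.mem_Icc.2 ⟨h1, h6⟩)

theorem MemCb.hasDerivWithinAt {m : ℕ} {h : ℝ → ℝ} (hh : MemCb m h) {k : ℕ} (hk : k < m) {x : ℝ}
    (hx : 0 ≤ x) : HasDerivWithinAt (iteratedDerivWithin k h halfLine)
      (iteratedDerivWithin (k + 1) h halfLine x) halfLine x := by
  rw [iteratedDerivWithin_succ]
  exact (hh.differentiableOn k hk x hx).hasDerivWithinAt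

theorem MemCb.hasDerivWithinAt_one {m : ℕ} {h : ℝ → ℝ} (hh : MemCb m h) (hm : 0 < m) {x : ℝ}
    (hx : 0 ≤ x) : HasDerivWithinAt h (iteratedDerivWithin 1 h halfLine x) halfLine x := by
  have := hh.hasDerivWithinAt hm hx
  rwa [iteratedDerivWithin_zero] at this

/-- The successive derivatives of `h - h 0` on the half-line. -/
noncomputable def centredDerivs (h : ℝ → ℝ) : ℕ → ℝ → ℝ
  | 0 => fun x => h x - h 0
  | k + 1 => iteratedDerivWithin (k + 1) h halfLine

/-- The seminorm does not see constants, so h(0) is subtracted; the mean value inequality then gives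
linear growth. The index set is the whole class of test functions, which yields the uniformity in h.
-/
theorem derivSeq_centredDerivs :
    DerivSeq (fun h : {h : ℝ → ℝ // MemCb 6 h} => hNorm 6 h.1) 6
      (fun h => centredDerivs h.1) where
  hasDeriv h k hk x hx := by
    cases k with
    | zero => exact (h.2.hasDerivWithinAt_one (by omega) hx).sub_const (h.1 0)
    | succ k => exact h.2.hasDerivWithinAt hk hx
  bound h k hk x hx := by
    have hM := hNorm_nonneg 6 h.1
    cases k with
    | zero =>
      have := (convex_Ici (0 : ℝ)).norm_image_sub_le_of_norm_hasDerivWithin_le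
        (f := h.1) (f' := iteratedDerivWithin 1 h.1 halfLine) (s := halfLine) (C := hNorm 6 h.1)
        (x := 0) (y := x)
        (fun y hy => h.2.hasDerivWithinAt_one (by omega) (Set.mem_Ici.1 hy))
        (fun y hy => (h.2.abs_le_derivNorm le_rfl (by omega) hy).trans
          (derivNorm_le_hNorm_six h.1 le_rfl (by omega))) (Set.mem_Ici.2 le_rfl) hx
      rw [sub_zero, Real.norm_eq_abs, Real.norm_eq_abs, abs_of_nonneg hx] at this
      refine this.trans ?_
      gcongr
      linarith
    | succ k =>
      refine ((h.2.abs_le_derivNorm (by omega) hk hx).trans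
        (derivNorm_le_hNorm_six h.1 (by omega) hk)).trans ?_
      exact le_mul_of_one_le_right hM (by linarith)

/-- Two applications of the mean value inequality between a and b, the first one to h'. -/
theorem MemCb.abs_first_order_le {h : ℝ → ℝ} (hh : MemCb 6 h) {a b : ℝ} (ha : 0 ≤ a) (hb : 0 ≤ b) :
    |centredDerivs h 0 b - centredDerivs h 0 a - centredDerivs h 1 a * (b - a)|
      ≤ hNorm 6 h * (b - a) ^ 2 := by
  set S := Set.uIcc a b
  have hS : S ⊆ Set.Ici 0 := fun x hx => (le_min ha hb).trans hx.1
  have hd : ∀ k < 6, ∀ x ∈ S, HasDerivWithinAt (centredDerivs h k) (centredDerivs h (k + 1) x) S x :=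
    fun k hk x hx => (derivSeq_centredDerivs.hasDeriv ⟨h, hh⟩ k hk x (hS hx)).mono hS
  have h1 : ∀ x ∈ S, ‖centredDerivs h 1 x - centredDerivs h 1 a‖ ≤ hNorm 6 h * |b - a| := by
    intro x hx
    have := (convex_uIcc a b).norm_image_sub_le_of_norm_hasDerivWithin_le
      (C := hNorm 6 h) (hd 1 (by omega)) (fun y hy =>
        (hh.abs_le_derivNorm (k := 2) (by omega) (by omega) (hS hy)).trans
          (derivNorm_le_hNorm_six h (by omega) (by omega))) Set.left_mem_uIcc hx
    refine this.trans (mul_le_mul_of_nonneg_left ?_ (hNorm_nonneg 6 h))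
    exact Set.abs_sub_left_of_mem_uIcc hx
  have h2 : ∀ x ∈ S, HasDerivWithinAt (fun x => centredDerivs h 0 x - centredDerivs h 1 a * x)
      (centredDerivs h 1 x - centredDerivs h 1 a) S x := fun x hx => by
    have := (hd 0 (by omega) x hx).sub ((hasDerivWithinAt_id x S).const_mul
      (centredDerivs h 1 a))
    rwa [mul_one] at this
  have := (convex_uIcc a b).norm_image_sub_le_of_norm_hasDerivWithin_le h2 h1
    Set.left_mem_uIcc Set.right_mem_uIcc
  rw [Real.norm_eq_abs, Real.norm_eq_abs, mul_assoc, ← pow_two, sq_abs] at this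
  convert this using 2
  ring

/-- On the negative axis h is arbitrary, possibly nonmeasurable; this continuous modification agrees
with h on the half-line. -/
theorem MemCb.continuous_comp_max {h : ℝ → ℝ} (hh : MemCb 6 h) :
    Continuous fun x => h (max x 0) := by
  have : ContinuousOn h halfLine := by
    simpa only [iteratedDerivWithin_zero] using (hh.differentiableOn 0 (by omega)).continuousOn
  exact this.comp_continuous (by fun_prop) fun x => le_max_right x 0

end TestFunctions

/-! ### Third-order expansion of (1 + y)^q. -/

section PowerExpansion

/-- The cubic Taylor polynomial of `(1 + y) ^ q`. -/
noncomputable def rpowTaylor (q y : ℝ) : ℝ :=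
  1 + q * y + q * (q - 1) / 2 * y ^ 2 + q * (q - 1) * (q - 2) / 6 * y ^ 3

theorem abs_rpow_sub_taylor_le_near (q : ℝ) :
    ∃ C, 0 ≤ C ∧ ∀ y, |y| ≤ 1 / 2 → |(1 + y) ^ q - rpowTaylor q y| ≤ C * y ^ 4 := by
  set c : ℝ := |q * (q - 1) * (q - 2) * (q - 3)|
  -- The power q - 4 is monotone in its base, in a direction given by its sign, so on [1/2, 3/2] it
  -- is bounded by an endpoint value; the sum covers both cases.
  set K : ℝ := (1 / 2 : ℝ) ^ (q - 4) + (3 / 2 : ℝ) ^ (q - 4)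
  have hK : 0 ≤ K := by positivity
  refine ⟨c * K, by positivity, fun y hy => ?_⟩
  have hy' := abs_le.1 hy
  have hpos : ∀ t ∈ Set.Icc (0 : ℝ) 1, 1 / 2 ≤ 1 + t * y ∧ 1 + t * y ≤ 3 / 2 := by
    intro t ht
    constructor <;> nlinarith [ht.1, ht.2, hy'.1, hy'.2]
  let co : ℕ → ℝ := fun k => match k with
    | 0 => 1
    | 1 => q
    | 2 => q * (q - 1)
    | 3 => q * (q - 1) * (q - 2)
    | _ => q * (q - 1) * (q - 2) * (q - 3)
  have hco : ∀ k < 4, co (k + 1) = co k * (q - k) := by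
    intro k hk
    interval_cases k <;> simp [co]
  have key := abs_sub_taylor_sum_le (m := 4) (K := c * K * y ^ 4)
    (fun k t => co k * y ^ k * (1 + t * y) ^ (q - k)) ?_ ?_ 1 (by simp)
  · have e : (1 + y) ^ q - rpowTaylor q y = co 0 * y ^ 0 * (1 + 1 * y) ^ (q - (0 : ℕ))
        - ∑ k ∈ Finset.range 4, co k * y ^ k * (1 + 0 * y) ^ (q - (k : ℕ))
          * (1 ^ k / (k.factorial : ℝ)) := by
      simp only [Finset.sum_range_succ, Finset.sum_range_zero, co, rpowTaylor, zero_mul, add_zero,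
        Real.one_rpow, one_pow, Nat.factorial]
      norm_num
      ring
    rw [e]
    exact key
  · intro k hk t ht
    have h1 : HasDerivAt (fun t : ℝ => 1 + t * y) y t := by
      simpa using ((hasDerivAt_id t).mul_const y).const_add 1
    have h2 := (h1.rpow_const (p := q - k) (Or.inl (by linarith [(hpos t ht).1]))).const_mul
      (co k * y ^ k)
    convert! h2 using 1
    rw [hco k hk]
    push_cast
    rw [show q - (k + 1) = q - k - 1 by ring, pow_succ]
    ring
  · intro t ht
    obtain ⟨l, u⟩ := hpos t ht
    have h0 : 0 ≤ (1 + t * y) ^ (q - (4 : ℕ)) := by positivity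
    have h1 : (1 + t * y) ^ (q - (4 : ℕ)) ≤ K := by
      push_cast
      rcases le_total 0 (q - 4) with hq | hq
      · have := Real.rpow_le_rpow (by linarith) u hq
        have : 0 ≤ (1 / 2 : ℝ) ^ (q - 4) := by positivity
        simp only [K]; linarith
      · have := Real.rpow_le_rpow_of_nonpos (by norm_num) l hq
        have : 0 ≤ (3 / 2 : ℝ) ^ (q - 4) := by positivity
        simp only [K]; linarith
    rw [abs_mul, abs_mul, abs_of_nonneg h0, abs_of_nonneg (by positivity : (0 : ℝ) ≤ y ^ 4)]
    calc _ = c * (1 + t * y) ^ (q - (4 : ℕ)) * y ^ 4 := by simp only [co, c]; ring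
      _ ≤ _ := by gcongr

/-- Empty cells give y = -1, so the local expansion does not suffice. For |y| ≥ 1/2 every term is at
most a multiple of (1 + |y|)^N, and 1 ≤ 16 y⁴ supplies the missing fourth power. -/
theorem abs_rpow_sub_taylor_le {q : ℝ} (hq : 1 ≤ q) :
    ∃ (C : ℝ) (N : ℕ), 0 ≤ C ∧ ∀ y, -1 ≤ y →
      |(1 + y) ^ q - rpowTaylor q y| ≤ C * (y ^ 4 * (1 + |y|) ^ N) := by
  obtain ⟨C, hC, hnear⟩ := abs_rpow_sub_taylor_le_near q
  set N := ⌈q⌉₊ + 3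
  set D : ℝ := 2 + |q| + |q * (q - 1) / 2| + |q * (q - 1) * (q - 2) / 6|
  refine ⟨C + 16 * D, N, by positivity, fun y hy => ?_⟩
  have hy1 : (1 : ℝ) ≤ 1 + |y| := by linarith [abs_nonneg y]
  have hN : (1 : ℝ) ≤ (1 + |y|) ^ N := one_le_pow₀ hy1
  have hy4 : 0 ≤ y ^ 4 := by positivity
  rcases le_total |y| (1 / 2) with h | h
  · refine (hnear y h).trans ?_
    have : C ≤ C + 16 * D := by have : 0 ≤ D := by positivity
                                linarith
    calc C * y ^ 4 = C * (y ^ 4 * 1) := by ring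
      _ ≤ (C + 16 * D) * (y ^ 4 * (1 + |y|) ^ N) := by gcongr
  · have h1 : |(1 + y) ^ q| ≤ (1 + |y|) ^ N := by
      rw [abs_of_nonneg (Real.rpow_nonneg (by linarith) q)]
      calc (1 + y) ^ q ≤ (1 + |y|) ^ q :=
            Real.rpow_le_rpow (by linarith) (by linarith [le_abs_self y]) (by linarith)
        _ ≤ (1 + |y|) ^ (N : ℝ) := by
            refine Real.rpow_le_rpow_of_exponent_le hy1 ?_
            have := Nat.le_ceil q
            simp only [N]; push_cast; linarith
        _ = _ := Real.rpow_natCast _ _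
    have h2 : ∀ k ≤ 3, |y ^ k| ≤ (1 + |y|) ^ N := by
      intro k hk
      rw [abs_pow]
      exact (pow_le_pow_left₀ (abs_nonneg y) (by linarith) k).trans
        (pow_le_pow_right₀ hy1 (by omega))
    have e1 : |q * y| ≤ |q| * (1 + |y|) ^ N := by
      rw [abs_mul]
      have := h2 1 (by omega)
      rw [pow_one] at this
      gcongr
    have e2 : |q * (q - 1) / 2 * y ^ 2| ≤ |q * (q - 1) / 2| * (1 + |y|) ^ N := by
      rw [abs_mul]
      exact mul_le_mul_of_nonneg_left (h2 2 (by omega)) (abs_nonneg _)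
    have e3 : |q * (q - 1) * (q - 2) / 6 * y ^ 3|
        ≤ |q * (q - 1) * (q - 2) / 6| * (1 + |y|) ^ N := by
      rw [abs_mul]
      exact mul_le_mul_of_nonneg_left (h2 3 (by omega)) (abs_nonneg _)
    have hD : |(1 + y) ^ q - rpowTaylor q y| ≤ D * (1 + |y|) ^ N := by
      unfold rpowTaylor
      have a1 := abs_le.1 h1
      have a2 := abs_le.1 e1
      have a3 := abs_le.1 e2
      have a4 := abs_le.1 e3
      simp only [D]
      rw [abs_le]
      constructor <;> linarith [a1.1, a1.2, a2.1, a2.2, a3.1, a3.2, a4.1, a4.2]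
    have h16 : 1 ≤ 16 * y ^ 4 := by
      have h4 : (1 / 2 : ℝ) ^ 4 ≤ |y| ^ 4 := pow_le_pow_left₀ (by norm_num) h 4
      rw [← abs_pow, abs_of_nonneg hy4] at h4
      norm_num at h4
      linarith
    have hD0 : 0 ≤ D := by positivity
    calc |(1 + y) ^ q - rpowTaylor q y| ≤ D * (1 + |y|) ^ N * 1 := by rw [mul_one]; exact hD
      _ ≤ D * (1 + |y|) ^ N * (16 * y ^ 4) := by gcongr
      _ ≤ D * (1 + |y|) ^ N * (16 * y ^ 4) + C * (y ^ 4 * (1 + |y|) ^ N) :=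
          le_add_of_nonneg_right (by positivity)
      _ = _ := by ring

end PowerExpansion

/-! ### Orthonormal frames of a hyperplane. -/

section Frame

/-- An orthonormal frame of the hyperplane orthogonal to a unit vector. -/
structure IsFrame {d : ℕ} (u : Fin (d + 1) → ℝ) (B : Fin (d + 1) → Fin d → ℝ) : Prop where
  orthogonal : ∀ a, ∑ j, u j * B j a = 0
  columns : ∀ a b, ∑ j, B j a * B j b = if a = b then 1 else 0
  rows : ∀ j k, ∑ a, B j a * B k a = (if j = k then 1 else 0) - u j * u k

/-- Extend u to an orthonormal basis and discard u itself. The row relations are Parseval's identity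
for pairs of standard basis vectors, with the contribution of u moved to the other side. -/
theorem exists_isFrame {d : ℕ} (u : Fin (d + 1) → ℝ) (hu : ∑ j, u j ^ 2 = 1) :
    ∃ B, IsFrame u B := by
  let e : Fin (d + 1) → EuclideanSpace ℝ (Fin (d + 1)) := fun _ => WithLp.toLp 2 u
  have he : ‖WithLp.toLp 2 u‖ = 1 := by
    rw [EuclideanSpace.norm_eq]
    simp [hu]
  have hon : Orthonormal ℝ (Set.domRestrict ({0} : Set (Fin (d + 1))) e) := by
    refine ⟨fun _ => he, fun i j hij => ?_⟩
    exact absurd (Subsingleton.elim i j) hij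
  obtain ⟨b, hb⟩ := hon.exists_orthonormalBasis_extension_of_card_eq (by simp)
  have hb0 : ∀ j, b 0 j = u j := fun j => by rw [hb 0 rfl]
  have hin : ∀ i k, ∑ j, b i j * b k j = if i = k then 1 else 0 := by
    intro i k
    have := orthonormal_iff_ite.1 b.orthonormal k i
    simp only [PiLp.inner_apply, RCLike.inner_apply, conj_trivial] at this
    rw [this]
    simp only [eq_comm]
  refine ⟨fun j a => b a.succ j, fun a => ?_, fun a c => ?_, fun j k => ?_⟩
  · have := hin 0 a.succ
    simp only [hb0] at this
    rw [this, if_neg (Fin.succ_ne_zero a).symm]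
  · rw [hin]
    simp [Fin.succ_inj]
  · have := b.sum_inner_mul_inner (EuclideanSpace.single j (1 : ℝ)) (EuclideanSpace.single k 1)
    simp only [EuclideanSpace.inner_single_left, EuclideanSpace.inner_single_right] at this
    rw [Fin.sum_univ_succ] at this
    simp only [hb0] at this
    have hs : (EuclideanSpace.single j (1 : ℝ)) k = if j = k then 1 else 0 := by
      simp [eq_comm]
    simp only [map_one, one_mul, conj_trivial] at this
    rw [hs] at this
    linarith

variable {d : ℕ} {u : Fin (d + 1) → ℝ} {B : Fin (d + 1) → Fin d → ℝ}

theorem IsFrame.sum_sq (hB : IsFrame u B) (v : Fin d → ℝ) :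
    ∑ j, (∑ a, B j a * v a) ^ 2 = ∑ a, v a ^ 2 := by
  have h : ∀ j, (∑ a, B j a * v a) ^ 2 = ∑ a, ∑ b, (v a * v b) * (B j a * B j b) := by
    intro j
    rw [pow_two, Finset.sum_mul_sum]
    refine Finset.sum_congr rfl fun a _ => Finset.sum_congr rfl fun b _ => ?_
    ring
  simp only [h]
  rw [Finset.sum_comm]
  refine Finset.sum_congr rfl fun a _ => ?_
  rw [Finset.sum_comm]
  simp only [← Finset.mul_sum, hB.columns]
  simp [pow_two]

end Frame

/-! ### Cell counts as sums of scores; expansion of the statistic. -/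

section Scores

variable {d : ℕ} {p : Fin (d + 1) → ℝ} {B : Fin (d + 1) → Fin d → ℝ}

/-- The standardized score of a trial that falls in class `j`. -/
noncomputable def cellScore (p : Fin (d + 1) → ℝ) (B : Fin (d + 1) → Fin d → ℝ)
    (j : Fin (d + 1)) : Fin d → ℝ :=
  fun a => B j a / Real.sqrt (p j)

/-- The normalized sum of the scores of `n` trials. -/
noncomputable def totalScore {n : ℕ} (p : Fin (d + 1) → ℝ) (B : Fin (d + 1) → Fin d → ℝ)
    (x : Fin n → Fin (d + 1)) : Fin d → ℝ :=
  ∑ i, (Real.sqrt n)⁻¹ • cellScore p B (x i)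

/-- The row relations say that BBᵀ is the projection onto the hyperplane. Applied to a score, `B`
therefore returns the centred class indicator divided by √p_j. -/
theorem sum_mul_cellScore (hp : ∀ j, 0 < p j) (hB : IsFrame (fun j => Real.sqrt (p j)) B)
    (j k : Fin (d + 1)) :
    ∑ a, B j a * cellScore p B k a = (if k = j then 1 else 0) / Real.sqrt (p j)
      - Real.sqrt (p j) := by
  have h := hB.rows j k
  have hk : Real.sqrt (p k) ≠ 0 := (Real.sqrt_pos.2 (hp k)).ne'
  have hj : Real.sqrt (p j) ≠ 0 := (Real.sqrt_pos.2 (hp j)).ne'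
  simp only [cellScore, ← mul_div_assoc, ← Finset.sum_div, h]
  by_cases hjk : j = k
  · subst hjk
    simp
    field_simp
  · rw [if_neg hjk, if_neg (fun h => hjk h.symm)]
    field_simp
    ring

theorem sum_mul_totalScore {n : ℕ} (hp : ∀ j, 0 < p j)
    (hB : IsFrame (fun j => Real.sqrt (p j)) B) (x : Fin n → Fin (d + 1)) (j : Fin (d + 1)) :
    ∑ a, B j a * totalScore p B x a
      = (Real.sqrt n)⁻¹ * (cellCount x j / Real.sqrt (p j) - n * Real.sqrt (p j)) := by
  have h : ∀ a, B j a * totalScore p B x a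
      = ∑ i, (Real.sqrt n)⁻¹ * (B j a * cellScore p B (x i) a) := by
    intro a
    simp only [totalScore, Finset.sum_apply, Pi.smul_apply, smul_eq_mul, Finset.mul_sum]
    refine Finset.sum_congr rfl fun i _ => ?_
    ring
  simp only [h]
  rw [Finset.sum_comm]
  simp only [← Finset.mul_sum, sum_mul_cellScore hp hB, Finset.sum_sub_distrib]
  congr 2
  · rw [← Finset.sum_div]
    simp [cellCount]
  · simp

/-- The relative deviation of a cell count. -/
theorem cellCount_div_sub_one {n : ℕ} (hn : 1 ≤ n) (hp : ∀ j, 0 < p j)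
    (hB : IsFrame (fun j => Real.sqrt (p j)) B) (x : Fin n → Fin (d + 1)) (j : Fin (d + 1)) :
    (cellCount x j : ℝ) / (n * p j) - 1
      = (Real.sqrt n)⁻¹ * ((∑ a, B j a * totalScore p B x a) / Real.sqrt (p j)) := by
  rw [sum_mul_totalScore hp hB]
  have hn0 : (0 : ℝ) < n := by exact_mod_cast hn
  have h1 : Real.sqrt n ≠ 0 := (Real.sqrt_pos.2 hn0).ne'
  have h2 : Real.sqrt (p j) ≠ 0 := (Real.sqrt_pos.2 (hp j)).ne'
  have e1 : Real.sqrt n ^ 2 = n := Real.sq_sqrt hn0.le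
  have e2 : Real.sqrt (p j) ^ 2 = p j := Real.sq_sqrt (hp j).le
  have h3 := (hp j).ne'
  field_simp
  rw [e1, e2]
  field_simp

theorem sum_cellCount {n r : ℕ} (x : Fin n → Fin r) : ∑ j, (cellCount x j : ℝ) = n := by
  have := Finset.card_eq_sum_card_fiberwise (s := (Finset.univ : Finset (Fin n)))
    (t := (Finset.univ : Finset (Fin r))) (f := x) (fun _ _ => Finset.mem_coe.2 (Finset.mem_univ _))
  simp only [Finset.card_univ, Fintype.card_fin] at this
  conv_rhs => rw [this]
  push_cast
  rfl

/-- The power divergence statistic in terms of the relative deviations of the cell counts. -/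
theorem powerDivergence_eq {n r : ℕ} (hn : 1 ≤ n) {lam : ℝ} (hl : 0 < lam) {p : Fin r → ℝ}
    (hp : ∀ j, 0 < p j) (hsum : ∑ j, p j = 1) (x : Fin n → Fin r) {y : Fin r → ℝ}
    (hy : ∀ j, (cellCount x j : ℝ) / (n * p j) - 1 = y j) :
    powerDivergence lam p x = 2 / (lam * (lam + 1)) *
      ∑ j, n * p j * ((1 + y j) ^ (lam + 1) - 1 - (lam + 1) * y j) := by
  have hn0 : (0 : ℝ) < n := by exact_mod_cast hn
  have hU : ∀ j, (cellCount x j : ℝ) = n * p j * (1 + y j) := by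
    intro j
    have := (hp j).ne'
    rw [← hy j]
    field_simp
    ring
  -- The counts sum to n, so linear terms in the deviations cancel over the cells and may be added
  -- freely.
  have h0 : ∑ j, n * p j * y j = 0 := by
    have h := sum_cellCount x
    simp only [hU, mul_add, Finset.sum_add_distrib, mul_one, ← Finset.mul_sum, hsum] at h
    simp only [mul_assoc] at h ⊢
    rw [← Finset.mul_sum] at h ⊢
    linarith
  have hterm : ∀ j, (cellCount x j : ℝ) * (((cellCount x j : ℝ) / (n * p j)) ^ lam - 1)
      = n * p j * ((1 + y j) ^ (lam + 1) - 1 - (lam + 1) * y j) + lam * (n * p j * y j) := by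
    intro j
    have e : (cellCount x j : ℝ) / (n * p j) = 1 + y j := by rw [← hy j]; ring
    have h1 : 0 ≤ 1 + y j := by
      rw [← e]
      have := hp j
      positivity
    have e2 : (1 + y j) ^ (lam + 1) = (1 + y j) ^ lam * (1 + y j) := by
      rcases h1.eq_or_lt with h | h
      · rw [← h, Real.zero_rpow (by linarith), mul_zero]
      · rw [Real.rpow_add_one h.ne']
    rw [e, hU j, e2]
    ring
  unfold powerDivergence
  simp only [hterm, Finset.sum_add_distrib]
  rw [← Finset.mul_sum (f := fun j => n * p j * y j), h0]
  ring

theorem neg_one_le_of_cellCount {n r : ℕ} {p : Fin r → ℝ} (hp : ∀ j, 0 < p j)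
    (x : Fin n → Fin r) {y : Fin r → ℝ} (hy : ∀ j, (cellCount x j : ℝ) / (n * p j) - 1 = y j)
    (j : Fin r) : -1 ≤ y j := by
  rw [← hy j]
  have := hp j
  have : 0 ≤ (cellCount x j : ℝ) / (n * p j) := by positivity
  linarith

/-- Bernoulli's inequality with exponent λ + 1, cell by cell. The sign matters because h is
controlled on the half-line only. -/
theorem powerDivergence_nonneg {n r : ℕ} (hn : 1 ≤ n) {lam : ℝ} (hl : 0 < lam) {p : Fin r → ℝ}
    (hp : ∀ j, 0 < p j) (hsum : ∑ j, p j = 1) (x : Fin n → Fin r) :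
    0 ≤ powerDivergence lam p x := by
  rw [powerDivergence_eq hn hl hp hsum x fun _ => rfl]
  refine mul_nonneg (by positivity) (Finset.sum_nonneg fun j _ => ?_)
  have h1 := one_add_mul_self_le_rpow_one_add
    (neg_one_le_of_cellCount hp x (fun _ => rfl) j) (p := lam + 1) (by linarith)
  have := hp j
  refine mul_nonneg (by positivity) ?_
  linarith

/-- The cubic form in the expansion of the power divergence statistic. -/
noncomputable def cubicForm (lam : ℝ) (p : Fin (d + 1) → ℝ) (B : Fin (d + 1) → Fin d → ℝ)
    (v : Fin d → ℝ) : ℝ :=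
  ∑ j, (lam - 1) / (3 * Real.sqrt (p j)) * (∑ a, B j a * v a) ^ 3

theorem abs_linear_le (c : Fin d → ℝ) (v : Fin d → ℝ) :
    |∑ a, c a * v a| ≤ (∑ a, |c a|) * ‖v‖ := by
  refine (Finset.abs_sum_le_sum_abs _ _).trans ?_
  rw [Finset.sum_mul]
  refine Finset.sum_le_sum fun a _ => ?_
  rw [abs_mul]
  exact mul_le_mul_of_nonneg_left (abs_coord_le v a) (abs_nonneg _)

/-- With y_j = s z_j and n s² = 1, a term n y_j^k has order s^{k-2}. The quadratic terms add up to
|W|² because the frame is isometric, the cubic ones give s times the cubic form, and the quartic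
remainder is O(s²). -/
theorem powerDivergence_expansion {lam : ℝ} (hl : 0 < lam) (hp : ∀ j, 0 < p j)
    (hsum : ∑ j, p j = 1) (hB : IsFrame (fun j => Real.sqrt (p j)) B) :
    ∃ (C : ℝ) (N : ℕ), 0 ≤ C ∧ ∀ n : ℕ, 1 ≤ n → ∀ x : Fin n → Fin (d + 1),
      |powerDivergence lam p x - ∑ a, totalScore p B x a ^ 2
        - (Real.sqrt n)⁻¹ * cubicForm lam p B (totalScore p B x)|
        ≤ C * (Real.sqrt n)⁻¹ ^ 2 * (1 + ‖totalScore p B x‖) ^ N := by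
  obtain ⟨C, N, hC, hR⟩ := abs_rpow_sub_taylor_le (q := lam + 1) (by linarith)
  set K : Fin (d + 1) → ℝ := fun j => (∑ a, |B j a|) / Real.sqrt (p j) with hKdef
  have hK : ∀ j, 0 ≤ K j := fun j => by simp only [hKdef]; positivity
  set c : ℝ := 2 / (lam * (lam + 1)) with hc
  have hc0 : 0 ≤ c := by positivity
  refine ⟨c * ∑ j, p j * C * K j ^ 4 * (1 + K j) ^ N, N + 4,
    mul_nonneg hc0 (Finset.sum_nonneg fun j _ => ?_), fun n hn x => ?_⟩
  · have := hp j
    have := hK j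
    positivity
  have hn0 : (0 : ℝ) < n := by exact_mod_cast hn
  set v := totalScore p B x with hv
  set s : ℝ := (Real.sqrt n)⁻¹ with hs
  have hs0 : 0 ≤ s := by positivity
  have hs1 : s ≤ 1 := inv_le_one_of_one_le₀ (Real.one_le_sqrt.2 (by exact_mod_cast hn))
  have hsn : n * s ^ 2 = 1 := by
    rw [hs, inv_pow, Real.sq_sqrt hn0.le]
    exact mul_inv_cancel₀ hn0.ne'
  set l : Fin (d + 1) → ℝ := fun j => ∑ a, B j a * v a with hldef
  set y : Fin (d + 1) → ℝ := fun j => s * (l j / Real.sqrt (p j)) with hy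
  have hyU : ∀ j, (cellCount x j : ℝ) / (n * p j) - 1 = y j :=
    fun j => cellCount_div_sub_one hn hp hB x j
  have hy1 := neg_one_le_of_cellCount hp x hyU
  have hlb : ∀ j, |l j / Real.sqrt (p j)| ≤ K j * ‖v‖ := by
    intro j
    rw [abs_div, abs_of_nonneg (Real.sqrt_nonneg _), hKdef]
    have := abs_linear_le (B j) v
    rw [div_mul_eq_mul_div]
    gcongr
  set R : Fin (d + 1) → ℝ := fun j => (1 + y j) ^ (lam + 1) - rpowTaylor (lam + 1) (y j)
  have hRj : ∀ j, |n * p j * R j|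
      ≤ (p j * C * K j ^ 4 * (1 + K j) ^ N) * (s ^ 2 * (1 + ‖v‖) ^ (N + 4)) := by
    intro j
    have hpj := hp j
    have hKj := hK j
    set z := l j / Real.sqrt (p j)
    have hz := hlb j
    have hv0 := norm_nonneg v
    have hz4 : z ^ 4 ≤ (K j) ^ 4 * (1 + ‖v‖) ^ 4 := by
      calc z ^ 4 = |z| ^ 4 := by rw [← abs_pow, abs_of_nonneg (by positivity)]
        _ ≤ (K j * ‖v‖) ^ 4 := pow_le_pow_left₀ (abs_nonneg _) hz 4
        _ ≤ (K j * (1 + ‖v‖)) ^ 4 := by gcongr; linarith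
        _ = _ := mul_pow _ _ _
    have hzN : (1 + |y j|) ^ N ≤ (1 + K j) ^ N * (1 + ‖v‖) ^ N := by
      rw [← mul_pow]
      refine pow_le_pow_left₀ (by positivity) ?_ N
      have : |y j| ≤ |z| := by
        simp only [hy, abs_mul, abs_of_nonneg hs0]
        exact mul_le_of_le_one_left (abs_nonneg _) hs1
      nlinarith
    have e : (n : ℝ) * y j ^ 4 = s ^ 2 * z ^ 4 := by
      calc (n : ℝ) * y j ^ 4 = (n * s ^ 2) * (s ^ 2 * z ^ 4) := by simp only [hy, z]; ring
        _ = _ := by rw [hsn, one_mul]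
    rw [abs_mul, abs_of_nonneg (by positivity)]
    calc n * p j * |R j| ≤ n * p j * (C * (y j ^ 4 * (1 + |y j|) ^ N)) := by
          gcongr
          exact hR (y j) (hy1 j)
      _ = p j * C * (n * y j ^ 4) * (1 + |y j|) ^ N := by ring
      _ = p j * C * (s ^ 2 * z ^ 4) * (1 + |y j|) ^ N := by rw [e]
      _ ≤ p j * C * (s ^ 2 * ((K j) ^ 4 * (1 + ‖v‖) ^ 4)) * ((1 + K j) ^ N * (1 + ‖v‖) ^ N) := by
          gcongr
      _ = _ := by ring
  have hmain : powerDivergence lam p x - ∑ a, v a ^ 2 - s * cubicForm lam p B v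
      = c * ∑ j, n * p j * R j := by
    rw [powerDivergence_eq hn hl hp hsum x hyU, ← hB.sum_sq v]
    unfold cubicForm
    rw [← hc]
    simp only [Finset.mul_sum, ← Finset.sum_sub_distrib]
    refine Finset.sum_congr rfl fun j _ => ?_
    have hsp : Real.sqrt (p j) ≠ 0 := (Real.sqrt_pos.2 (hp j)).ne'
    have hpj : p j = Real.sqrt (p j) ^ 2 := (Real.sq_sqrt (hp j).le).symm
    have e2 : n * p j * y j ^ 2 = l j ^ 2 := by
      calc n * p j * y j ^ 2 = (n * s ^ 2) * (p j * (l j / Real.sqrt (p j)) ^ 2) := by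
            simp only [hy]; ring
        _ = _ := by
            rw [hsn, one_mul, div_pow, Real.sq_sqrt (hp j).le]
            have := (hp j).ne'
            field_simp
    have e3 : n * p j * y j ^ 3 = s * (l j ^ 3 / Real.sqrt (p j)) := by
      calc n * p j * y j ^ 3 = (n * p j * y j ^ 2) * y j := by ring
        _ = _ := by rw [e2]; simp only [hy]; ring
    have e4 : c * (lam * (lam + 1)) = 2 := by
      simp only [hc]
      field_simp
    have : c * (n * p j * ((1 + y j) ^ (lam + 1) - 1 - (lam + 1) * y j))
        = c * (n * p j * R j) + c * (lam * (lam + 1)) / 2 * (n * p j * y j ^ 2)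
          + c * (lam * (lam + 1)) * (lam - 1) / 6 * (n * p j * y j ^ 3) := by
      simp only [R, rpowTaylor]
      ring
    rw [this, e2, e3, e4]
    simp only [hldef]
    field_simp
    ring
  rw [hmain, abs_mul, abs_of_nonneg hc0, mul_assoc, mul_assoc, Finset.sum_mul]
  refine mul_le_mul_of_nonneg_left ?_ hc0
  exact (Finset.abs_sum_le_sum_abs _ _).trans (Finset.sum_le_sum fun j _ => hRj j)

end Scores

/-! ### The law of the scores and of their sum. -/

section ScoreLaw

variable {d : ℕ} {p : Fin (d + 1) → ℝ} {B : Fin (d + 1) → Fin d → ℝ}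

/-- The distribution of the class of one trial. -/
noncomputable def cellLaw {r : ℕ} (p : Fin r → ℝ) : Measure (Fin r) :=
  ∑ j, ENNReal.ofReal (p j) • Measure.dirac j

theorem cellLaw_singleton {r : ℕ} (p : Fin r → ℝ) (j : Fin r) :
    cellLaw p {j} = ENNReal.ofReal (p j) := by
  simp [cellLaw, Measure.finsetSum_apply, Set.indicator_apply]

theorem isProbabilityMeasure_cellLaw {r : ℕ} {p : Fin r → ℝ} (hp : ∀ j, 0 < p j)
    (hsum : ∑ j, p j = 1) : IsProbabilityMeasure (cellLaw p) := by
  constructor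
  simp [cellLaw, Measure.finsetSum_apply, ← ENNReal.ofReal_sum_of_nonneg fun j _ => (hp j).le, hsum]

theorem integral_cellLaw {r : ℕ} {p : Fin r → ℝ} (hp : ∀ j, 0 < p j) (g : Fin r → ℝ) :
    ∫ j, g j ∂(cellLaw p) = ∑ j, p j * g j := by
  unfold cellLaw
  rw [integral_finsetSum_measure fun j _ =>
    (integrable_dirac (by simp)).smul_measure ENNReal.ofReal_ne_top]
  refine Finset.sum_congr rfl fun j _ => ?_
  rw [integral_smul_measure, integral_dirac, ENNReal.toReal_ofReal (hp j).le, smul_eq_mul]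

/-- The distribution of the score of one trial. -/
noncomputable def scoreLaw (p : Fin (d + 1) → ℝ) (B : Fin (d + 1) → Fin d → ℝ) :
    Measure (Fin d → ℝ) :=
  (cellLaw p).map (cellScore p B)

theorem integral_scoreLaw (hp : ∀ j, 0 < p j) {g : (Fin d → ℝ) → ℝ} (hg : Continuous g) :
    ∫ v, g v ∂(scoreLaw p B) = ∑ j, p j * g (cellScore p B j) := by
  unfold scoreLaw
  rw [integral_map (by fun_prop) hg.aestronglyMeasurable, integral_cellLaw hp]

/-- Centring is the orthogonality of the frame to (√p_j); exponential moments are free because there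
are finitely many classes. -/
theorem centredExp_scoreLaw (hp : ∀ j, 0 < p j) (hsum : ∑ j, p j = 1)
    (hB : IsFrame (fun j => Real.sqrt (p j)) B) : CentredExp (scoreLaw p B) := by
  have := isProbabilityMeasure_cellLaw hp hsum
  refine ⟨Measure.isProbabilityMeasure_map (by fun_prop), ?_, fun a => ?_⟩
  · unfold scoreLaw
    rw [integrable_map_measure (by fun_prop) (by fun_prop)]
    exact Integrable.of_finite
  · rw [integral_scoreLaw hp (continuous_apply a), ← hB.orthogonal a]
    refine Finset.sum_congr rfl fun j _ => ?_
    have h1 : Real.sqrt (p j) ≠ 0 := (Real.sqrt_pos.2 (hp j)).ne'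
    have h2 := Real.mul_self_sqrt (hp j).le
    simp only [cellScore]
    field_simp
    rw [pow_two, h2, mul_comm]

theorem cov_scoreLaw (hp : ∀ j, 0 < p j) (hB : IsFrame (fun j => Real.sqrt (p j)) B)
    (a b : Fin d) : ∫ v, v a * v b ∂(scoreLaw p B) = if a = b then 1 else 0 := by
  rw [integral_scoreLaw hp (by fun_prop), ← hB.columns a b]
  refine Finset.sum_congr rfl fun j _ => ?_
  have h1 : Real.sqrt (p j) ≠ 0 := (Real.sqrt_pos.2 (hp j)).ne'
  have h2 := Real.mul_self_sqrt (hp j).le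
  simp only [cellScore]
  field_simp
  rw [pow_two, h2]
  ring

variable {Ω : Type*} [MeasurableSpace Ω] {P : Measure Ω} [IsProbabilityMeasure P]

theorem map_eq_cellLaw {r : ℕ} {p : Fin r → ℝ} {X : Ω → Fin r} (hX : Measurable X)
    (hlaw : ∀ j, P.real {ω | X ω = j} = p j) : P.map X = cellLaw p := by
  refine Measure.ext_of_singleton fun j => ?_
  rw [cellLaw_singleton, Measure.map_apply hX (measurableSet_singleton j), ← hlaw j]
  exact (ofReal_measureReal).symm

theorem map_totalScore (γ : Measure (Fin d → ℝ)) {n : ℕ} {X : Fin n → Ω → Fin (d + 1)}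
    (hX : ∀ i, Measurable (X i)) (hind : iIndepFun X P)
    (hlaw : ∀ i j, P.real {ω | X i ω = j} = p j) :
    P.map (fun ω => totalScore p B fun i => X i ω)
      = mixLaw (scoreLaw p B) γ (Real.sqrt n)⁻¹ n 0 := by
  set s := (Real.sqrt n)⁻¹
  set Y : Fin n → Ω → (Fin d → ℝ) := fun i => (fun j => s • cellScore p B j) ∘ X i with hY
  have hYm : ∀ i, Measurable (Y i) := fun i => (Measurable.of_discrete).comp (hX i)
  have hYind : iIndepFun Y P := hind.comp _ fun i => Measurable.of_discrete
  have hYlaw : ∀ i, P.map (Y i) = scaleLaw s (scoreLaw p B) := by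
    intro i
    unfold scaleLaw scoreLaw
    rw [Measure.map_map (by fun_prop) (by fun_prop), ← map_eq_cellLaw (hX i) (hlaw i),
      Measure.map_map (by fun_prop) (hX i)]
    rfl
  have key : ∀ S : Finset (Fin n), P.map (∑ i ∈ S, Y i) = mixLaw (scoreLaw p B) γ s S.card 0 := by
    intro S
    induction S using Finset.induction_on with
    | empty =>
      simp only [Finset.sum_empty, Finset.card_empty, mixLaw]
      change P.map (fun _ => (0 : Fin d → ℝ)) = _
      rw [Measure.map_const]
      simp
    | insert i S hi ih =>
      have hSm : Measurable (∑ i ∈ S, Y i) := by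
        convert! Finset.measurable_sum S fun i _ => hYm i using 1
        funext ω
        simp
      rw [Finset.sum_insert hi, Finset.card_insert_of_notMem hi, add_comm,
        (hYind.indepFun_finsetSum_of_notMem hYm hi).map_add_eq_map_conv_map hSm (hYm i), ih, hYlaw, mixLaw]
  have := key Finset.univ
  rw [Finset.card_univ, Fintype.card_fin] at this
  rw [← this]
  congr 1
  funext ω
  simp [totalScore, hY, s]

end ScoreLaw

/-! ### Chi-square expectations as Gaussian integrals. -/

section ChiSquare

theorem integrable_chiSquare {h : ℝ → ℝ} (hh : MemCb 6 h) (d : ℕ) :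
    Integrable h (chiSquare d) ∧
    ∫ y, h y ∂(chiSquare d) = ∫ z, h (∑ a, z a ^ 2) ∂(gaussPi d) := by
  have hm : Measurable fun z : Fin d → ℝ => ∑ a, z a ^ 2 := by fun_prop
  have hae : h =ᵐ[chiSquare d] fun x => h (max x 0) := by
    have : ∀ᵐ y ∂(chiSquare d), 0 ≤ y := by
      unfold chiSquare
      rw [ae_map_iff hm.aemeasurable measurableSet_Ici]
      exact Filter.Eventually.of_forall fun z => sum_sq_nonneg z
    filter_upwards [this] with y hy
    rw [max_eq_left hy]
  have hc := hh.continuous_comp_max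
  have hcs : chiSquare d = (gaussPi d).map fun z => ∑ a, z a ^ 2 := rfl
  have hmax : ∀ z : Fin d → ℝ, max (∑ a, z a ^ 2) 0 = ∑ a, z a ^ 2 :=
    fun z => max_eq_left (sum_sq_nonneg z)
  constructor
  · rw [integrable_congr hae, hcs, integrable_map_measure hc.aestronglyMeasurable hm.aemeasurable]
    set M : {h : ℝ → ℝ // MemCb 6 h} → ℝ := fun h => hNorm 6 h.1
    have hM : ∀ i, 0 ≤ M i := fun i => hNorm_nonneg 6 _
    have hu : UReg M 1 fun i (v : Fin d → ℝ) => centredDerivs i.1 0 (∑ a, v a ^ 2) :=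
      derivSeq_centredDerivs.uReg hM (by omega)
    have hi := centredExp_gaussPi.integrable_comp_smul hM hu.polyBdd hu.continuous (s := 1)
      (by simp) ⟨h, hh⟩ (0 : Fin d → ℝ)
    have := hi.add (integrable_const (h 0))
    refine this.congr (Filter.Eventually.of_forall fun z => ?_)
    simp [centredDerivs, hmax]
  · rw [integral_congr_ae hae, hcs, integral_map hm.aemeasurable hc.aestronglyMeasurable]
    simp only [hmax]

end ChiSquare

/-! ### Assembly of the estimates. -/

section Assembly

variable {d : ℕ} {p : Fin (d + 1) → ℝ} {B : Fin (d + 1) → Fin d → ℝ}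

theorem polyBdd_cubicForm (lam : ℝ) (p : Fin (d + 1) → ℝ) (B : Fin (d + 1) → Fin d → ℝ) :
    ∃ (C : ℝ) (N : ℕ), 0 ≤ C ∧ ∀ v, |cubicForm lam p B v| ≤ C * (1 + ‖v‖) ^ N := by
  have hM : ∀ i : Unit, (0 : ℝ) ≤ (fun _ => 1) i := fun _ => zero_le_one
  have h1 : UReg (fun _ : Unit => (1 : ℝ)) 0 fun _ (_ : Fin d → ℝ) => (1 : ℝ) :=
    ⟨1, 0, zero_le_one, by simp⟩
  obtain ⟨C, N, hC, h⟩ : UReg (fun _ : Unit => (1 : ℝ)) 0 fun _ v => cubicForm lam p B v := by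
    have : UReg (fun _ : Unit => (1 : ℝ)) 0 fun _ v =>
        ∑ j, (lam - 1) / (3 * Real.sqrt (p j)) * ((∑ a, B j a * v a) * ((∑ a, B j a * v a)
          * ((∑ a, B j a * v a) * 1))) :=
      UReg.sum hM _ fun j _ => UReg.const_mul _
        (((h1.linear_mul hM (B j)).linear_mul hM (B j)).linear_mul hM (B j))
    convert! this using 4
    unfold cubicForm
    refine Finset.sum_congr rfl fun j _ => ?_
    ring
  exact ⟨C, N, hC, fun v => by simpa using h () v⟩

theorem UReg.mul_cubicForm {ι : Type*} {M : ι → ℝ} (hM : ∀ i, 0 ≤ M i) {m : ℕ}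
    {F : ι → (Fin d → ℝ) → ℝ} (hF : UReg M m F) (lam : ℝ) (p : Fin (d + 1) → ℝ)
    (B : Fin (d + 1) → Fin d → ℝ) : UReg M m fun i v => F i v * cubicForm lam p B v := by
  have : UReg M m fun i v =>
      ∑ j, (lam - 1) / (3 * Real.sqrt (p j)) * ((∑ a, B j a * v a) * ((∑ a, B j a * v a)
        * ((∑ a, B j a * v a) * F i v))) :=
    UReg.sum hM _ fun j _ => UReg.const_mul _
      (((hF.linear_mul hM (B j)).linear_mul hM (B j)).linear_mul hM (B j))
  convert! this using 3
  unfold cubicForm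
  rw [Finset.mul_sum]
  refine Finset.sum_congr rfl fun j _ => ?_
  ring

theorem cubicForm_neg (lam : ℝ) (p : Fin (d + 1) → ℝ) (B : Fin (d + 1) → Fin d → ℝ)
    (v : Fin d → ℝ) : cubicForm lam p B (-v) = -cubicForm lam p B v := by
  unfold cubicForm
  simp only [Pi.neg_apply, mul_neg, Finset.sum_neg_distrib, Odd.neg_pow (by decide : Odd 3)]

theorem one_add_norm_pow_le_expWeight (v : Fin d → ℝ) (N : ℕ) :
    (1 + ‖v‖) ^ N ≤ N.factorial * Real.exp 1 * expWeight v := by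
  simpa using one_add_norm_pow_le v 0 N

/-- First-order Taylor for h at |W|². The increment T - |W|² is O(s), so its square is O(s²), like
the remainder in the expansion of T; the two sources give the two summands of `D`. -/
theorem test_function_expansion {lam : ℝ} (hl : 0 < lam) (hp : ∀ j, 0 < p j)
    (hsum : ∑ j, p j = 1) (hB : IsFrame (fun j => Real.sqrt (p j)) B) :
    ∃ C, 0 ≤ C ∧ ∀ h, MemCb 6 h → ∀ n : ℕ, 1 ≤ n → ∀ x : Fin n → Fin (d + 1),
      |centredDerivs h 0 (powerDivergence lam p x)
        - centredDerivs h 0 (∑ a, totalScore p B x a ^ 2)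
        - (Real.sqrt n)⁻¹ * (centredDerivs h 1 (∑ a, totalScore p B x a ^ 2)
          * cubicForm lam p B (totalScore p B x))|
        ≤ C * hNorm 6 h * (Real.sqrt n)⁻¹ ^ 2 * expWeight (totalScore p B x) := by
  obtain ⟨C, N, hC, hexp⟩ := powerDivergence_expansion hl hp hsum hB
  obtain ⟨C', N', hC', hcub⟩ := polyBdd_cubicForm lam p B
  set D : ℝ := C + (C + C') ^ 2
  set K : ℕ := 2 * (N + N')
  have hD : 0 ≤ D := by positivity
  refine ⟨D * (K.factorial * Real.exp 1), by positivity, fun h hh n hn x => ?_⟩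
  set v := totalScore p B x
  set s : ℝ := (Real.sqrt n)⁻¹
  set T := powerDivergence lam p x
  set Q := ∑ a, v a ^ 2
  set R := cubicForm lam p B v
  have hT : 0 ≤ T := powerDivergence_nonneg hn hl hp hsum x
  have hQ : 0 ≤ Q := sum_sq_nonneg v
  have hs0 : 0 ≤ s := by positivity
  have hs1 : s ≤ 1 := inv_le_one_of_one_le₀ (Real.one_le_sqrt.2 (by exact_mod_cast hn))
  have hM := hNorm_nonneg 6 h
  have hv1 : 1 ≤ 1 + ‖v‖ := by linarith [norm_nonneg v]
  have h1 := hexp n hn x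
  have h2 := hh.abs_first_order_le hQ hT
  have h3 : |centredDerivs h 1 Q| ≤ hNorm 6 h :=
    (hh.abs_le_derivNorm le_rfl (by omega) hQ).trans (derivNorm_le_hNorm_six h le_rfl (by omega))
  have hR := hcub v
  have hE : |T - Q - s * R| ≤ C * s ^ 2 * (1 + ‖v‖) ^ K := by
    refine h1.trans ?_
    have := pow_le_pow_right₀ hv1 (show N ≤ K by omega)
    gcongr
  have hTQ : |T - Q| ≤ (C + C') * s * (1 + ‖v‖) ^ (N + N') := by
    have e1 : |T - Q| ≤ |T - Q - s * R| + |s * R| := by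
      have := abs_add_le (T - Q - s * R) (s * R)
      rwa [sub_add_cancel] at this
    have e2 : |s * R| ≤ s * (C' * (1 + ‖v‖) ^ (N + N')) := by
      rw [abs_mul, abs_of_nonneg hs0]
      have := pow_le_pow_right₀ hv1 (show N' ≤ N + N' by omega)
      refine mul_le_mul_of_nonneg_left (hR.trans ?_) hs0
      gcongr
    have e3 : |T - Q - s * R| ≤ C * s * (1 + ‖v‖) ^ (N + N') := by
      refine h1.trans ?_
      have := pow_le_pow_right₀ hv1 (show N ≤ N + N' by omega)
      have : s ^ 2 ≤ s := by nlinarith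
      gcongr
    linarith
  have hTQ2 : (T - Q) ^ 2 ≤ (C + C') ^ 2 * s ^ 2 * (1 + ‖v‖) ^ K := by
    rw [← sq_abs]
    calc |T - Q| ^ 2 ≤ ((C + C') * s * (1 + ‖v‖) ^ (N + N')) ^ 2 :=
          pow_le_pow_left₀ (abs_nonneg _) hTQ 2
      _ = _ := by rw [mul_pow, mul_pow, ← pow_mul, mul_comm (N + N') 2]
  have e : centredDerivs h 0 T - centredDerivs h 0 Q - s * (centredDerivs h 1 Q * R)
      = (centredDerivs h 0 T - centredDerivs h 0 Q - centredDerivs h 1 Q * (T - Q))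
        + centredDerivs h 1 Q * (T - Q - s * R) := by ring
  rw [e]
  calc _ ≤ hNorm 6 h * (T - Q) ^ 2 + hNorm 6 h * |T - Q - s * R| := by
        refine (abs_add_le _ _).trans (add_le_add h2 ?_)
        rw [abs_mul]
        gcongr
    _ ≤ hNorm 6 h * ((C + C') ^ 2 * s ^ 2 * (1 + ‖v‖) ^ K)
        + hNorm 6 h * (C * s ^ 2 * (1 + ‖v‖) ^ K) := by gcongr
    _ = D * hNorm 6 h * s ^ 2 * (1 + ‖v‖) ^ K := by simp only [D]; ring
    _ ≤ D * hNorm 6 h * s ^ 2 * (K.factorial * Real.exp 1 * expWeight v) := by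
        gcongr
        exact one_add_norm_pow_le_expWeight v K
    _ = _ := by ring

/-- The chi-square approximation with a constant depending on `lam` and `p`. -/
theorem powerDivergence_chiSquare_bound {lam : ℝ} (hl : 0 < lam) (hp : ∀ j, 0 < p j)
    (hsum : ∑ j, p j = 1) :
    ∃ C, 0 ≤ C ∧ ∀ (n : ℕ), 1 ≤ n → ∀ (Ω : Type*) [MeasurableSpace Ω] (P : Measure Ω)
      [IsProbabilityMeasure P] (X : Fin n → Ω → Fin (d + 1)), (∀ i, Measurable (X i)) →
      iIndepFun X P → (∀ i j, P.real {ω | X i ω = j} = p j) → ∀ (h : ℝ → ℝ), MemCb 6 h →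
        Integrable (fun ω => h (powerDivergence lam p fun i => X i ω)) P ∧
        Integrable h (chiSquare d) ∧
        |(∫ ω, h (powerDivergence lam p fun i => X i ω) ∂P) - ∫ y, h y ∂(chiSquare d)|
          ≤ C * (n : ℝ)⁻¹ * hNorm 6 h := by
  obtain ⟨B, hB⟩ := exists_isFrame (fun j => Real.sqrt (p j)) (by
    simp only [Real.sq_sqrt (hp _).le, hsum])
  set ν := scoreLaw p B
  set γ := gaussPi d
  have hν : CentredExp ν := centredExp_scoreLaw hp hsum hB
  have hγ : CentredExp γ := centredExp_gaussPi
  have hcov : ∀ a b, ∫ x, x a * x b ∂ν = ∫ x, x a * x b ∂γ := fun a b => by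
    rw [cov_scoreLaw hp hB, cov_gaussPi]
  have hsymm : ∀ (g : (Fin d → ℝ) → ℝ), Continuous g → (∀ v, g (-v) = -g v) → ∀ s l,
      ∫ v, g v ∂(mixLaw ν γ s 0 l) = 0 := fun g hc hg s l => by
    rw [mixLaw_gaussPi]
    exact integral_odd_scaleLaw_gaussPi _ hc hg
  set M : {h : ℝ → ℝ // MemCb 6 h} → ℝ := fun h => hNorm 6 h.1
  have hM : ∀ i, 0 ≤ M i := fun i => hNorm_nonneg 6 _
  set F0 : {h : ℝ → ℝ // MemCb 6 h} → (Fin d → ℝ) → ℝ :=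
    fun i v => centredDerivs i.1 0 (∑ a, v a ^ 2) with hF0
  set F1 : {h : ℝ → ℝ // MemCb 6 h} → (Fin d → ℝ) → ℝ :=
    fun i v => centredDerivs i.1 1 (∑ a, v a ^ 2) * cubicForm lam p B v with hF1
  have r0 : UReg M 6 F0 := derivSeq_centredDerivs.uReg hM (by omega)
  have r1 : UReg M 3 F1 :=
    UReg.mul_cubicForm hM (derivSeq_centredDerivs.uReg hM (by omega)) lam p B
  have hodd : ∀ i v, F1 i (-v) = -F1 i v := fun i v => by
    simp only [hF1, cubicForm_neg, Pi.neg_apply, neg_sq, mul_neg]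
  have heven : ∀ i v, F0 i (-v) = F0 i v := fun i v => by
    simp only [hF0, Pi.neg_apply, neg_sq]
  obtain ⟨C0, hC0, b0⟩ := clt_second_order hM hν hγ hcov hsymm r0 heven
  obtain ⟨C1, hC1, b1⟩ := clt_first_order hM hν hγ hcov r1
  obtain ⟨C2, hC2, b2⟩ := test_function_expansion hl hp hsum hB
  obtain ⟨L, hL, hw⟩ := mixLaw_weightBdd_uniform hν hγ
  refine ⟨C2 * L + C0 + C1, by positivity, ?_⟩
  intro n hn Ω _ P _ X hX hind hlaw h hh
  have hn0 : (0 : ℝ) < n := by exact_mod_cast hn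
  set i : {h : ℝ → ℝ // MemCb 6 h} := ⟨h, hh⟩
  set s : ℝ := (Real.sqrt n)⁻¹ with hs
  have hs0 : 0 ≤ s := by positivity
  have hs1 : s ≤ 1 := inv_le_one_of_one_le₀ (Real.one_le_sqrt.2 (by exact_mod_cast hn))
  have hsI : s ∈ Set.Icc (0 : ℝ) 1 := ⟨hs0, hs1⟩
  have hs2 : s ^ 2 = (n : ℝ)⁻¹ := by rw [hs, inv_pow, Real.sq_sqrt hn0.le]
  have hsn : s ^ 2 * ((n + 0 : ℕ) : ℝ) ≤ 1 := by
    rw [hs2, add_zero, inv_mul_cancel₀ hn0.ne']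
  -- There are finitely many outcomes of the n trials, so every function of the outcome is
  -- integrable.
  have hfin : ∀ G : (Fin n → Fin (d + 1)) → ℝ, Integrable (fun ω => G fun i => X i ω) P := by
    intro G
    have hm : Measurable fun ω => fun i => X i ω := measurable_pi_lambda _ hX
    have : IsProbabilityMeasure (P.map fun ω => fun i => X i ω) :=
      Measure.isProbabilityMeasure_map hm.aemeasurable
    exact (Integrable.of_finite (f := G)
      (μ := P.map fun ω => fun i => X i ω)).comp_measurable hm
  obtain ⟨ic, ec⟩ := integrable_chiSquare hh d
  refine ⟨hfin fun x => h (powerDivergence lam p x), ic, ?_⟩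
  have hWm : Measurable fun ω => totalScore p B fun i => X i ω :=
    (Measurable.of_discrete (f := fun x : Fin n → Fin (d + 1) => totalScore p B x)).comp
      (measurable_pi_lambda _ hX)
  have hWlaw := map_totalScore γ (B := B) hX hind hlaw
  have hW : ∀ g : (Fin d → ℝ) → ℝ, Continuous g →
      ∫ ω, g (totalScore p B fun i => X i ω) ∂P = ∫ v, g v ∂(mixLaw ν γ s n 0) := by
    intro g hg
    rw [← hWlaw, integral_map hWm.aemeasurable hg.aestronglyMeasurable]
  -- √n · s = 1, so the Gaussian end of the telescope is exactly standard.
  have hγn : mixLaw ν γ s 0 (n + 0) = γ := by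
    rw [mixLaw_gaussPi, add_zero, hs, mul_inv_cancel₀ (Real.sqrt_pos.2 hn0).ne']
    simp [scaleLaw, γ]
  have k0 := b0 i s hsI n 0 hsn
  have k1 := b1 i s hsI n 0 hsn
  rw [hsymm (F1 i) (r1.continuous i) (hodd i), sub_zero] at k1
  rw [hγn] at k0
  have iT := hfin fun x => centredDerivs h 0 (powerDivergence lam p x)
  have iQ := hfin fun x => F0 i (totalScore p B x)
  have iR := hfin fun x => s * F1 i (totalScore p B x)
  have k2 : |∫ ω, centredDerivs h 0 (powerDivergence lam p fun i => X i ω) ∂P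
      - ∫ v, F0 i v ∂(mixLaw ν γ s n 0) - s * ∫ v, F1 i v ∂(mixLaw ν γ s n 0)|
      ≤ C2 * M i * s ^ 2 * L := by
    have iTQ : Integrable (fun ω => centredDerivs h 0 (powerDivergence lam p fun i => X i ω)
      - F0 i (totalScore p B fun i => X i ω)) P := iT.sub iQ
    rw [← hW _ (r0.continuous i), ← hW _ (r1.continuous i), ← integral_const_mul,
      ← integral_sub iT iQ, ← integral_sub iTQ iR]
    have iψ := hfin fun x => C2 * M i * s ^ 2 * expWeight (totalScore p B x)
    have := norm_integral_le_of_norm_le (f := fun ω =>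
      centredDerivs h 0 (powerDivergence lam p fun i => X i ω)
        - F0 i (totalScore p B fun i => X i ω) - s * F1 i (totalScore p B fun i => X i ω))
      iψ (Filter.Eventually.of_forall fun ω =>
      b2 h hh n hn fun i => X i ω)
    refine this.trans ?_
    rw [integral_const_mul, hW _ continuous_expWeight]
    have := hM i
    exact mul_le_mul_of_nonneg_left (hw s hsI n 0 hsn).le (by positivity)
  -- The constant h(0) appears in both expectations and cancels in their difference.
  have e1 : ∫ ω, centredDerivs h 0 (powerDivergence lam p fun i => X i ω) ∂P
      = ∫ ω, h (powerDivergence lam p fun i => X i ω) ∂P - h 0 := by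
    simp only [centredDerivs]
    rw [integral_sub (hfin fun x => h (powerDivergence lam p x)) (integrable_const _)]
    simp
  have e2 : ∫ v, F0 i v ∂γ = ∫ y, h y ∂(chiSquare d) - h 0 := by
    rw [ec]
    simp only [hF0, centredDerivs]
    have i2 : Integrable (fun z : Fin d → ℝ => h (∑ a, z a ^ 2)) γ := by
      have hi := hγ.integrable_comp_smul hM r0.polyBdd r0.continuous (s := 1)
        (by simp) i (0 : Fin d → ℝ)
      refine (hi.add (integrable_const (h 0))).congr (Filter.Eventually.of_forall fun z => ?_)
      simp [hF0, centredDerivs, i]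
    rw [integral_sub i2 (integrable_const _)]
    simp only [integral_const, probReal_univ, one_smul]
    rfl
  have k1' : |s * ∫ v, F1 i v ∂(mixLaw ν γ s n 0)| ≤ C1 * M i * s ^ 2 := by
    rw [abs_mul, abs_of_nonneg hs0]
    calc _ ≤ s * (C1 * M i * s) := by gcongr
      _ = _ := by ring
  rw [e1] at k2
  rw [e2] at k0
  have e3 : (C2 * L + C0 + C1) * (n : ℝ)⁻¹ * hNorm 6 h
      = C2 * M i * s ^ 2 * L + C0 * M i * s ^ 2 + C1 * M i * s ^ 2 := by
    rw [← hs2]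
    simp only [M, i]
    ring
  rw [e3, abs_le]
  have a0 := abs_le.1 k0
  have a1 := abs_le.1 k1'
  have a2 := abs_le.1 k2
  constructor <;> linarith [a0.1, a0.2, a1.1, a1.2, a2.1, a2.2]

end Assembly

theorem mainTheorem2 :
    -- the constant depends on the index and on the finite sequence `p_1, …, p_r` only
    ∃ C : ℝ → List ℝ → ℝ,
      ∀ (lam : ℝ), ((∃ m : ℕ, 1 ≤ m ∧ lam = m) ∨ 5 < lam) →
      ∀ (r : ℕ), 2 ≤ r →
      ∀ (p : Fin r → ℝ), (∀ j, 0 < p j) → ∑ j, p j = 1 →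
      ∀ (n : ℕ), 1 ≤ n →
      ∀ (Ω : Type*) [MeasurableSpace Ω] (P : Measure Ω) [IsProbabilityMeasure P]
        (X : Fin n → Ω → Fin r), (∀ i, Measurable (X i)) → iIndepFun X P →
        (∀ i j, P.real {ω | X i ω = j} = p j) →
      ∀ (h : ℝ → ℝ), MemCb 6 h →
        Integrable (fun ω => h (powerDivergence lam p fun i => X i ω)) P ∧
        Integrable h (chiSquare (r - 1)) ∧
        |(∫ ω, h (powerDivergence lam p fun i => X i ω) ∂P) - ∫ y, h y ∂(chiSquare (r - 1))|
          ≤ C lam (List.ofFn p) * (r : ℝ) ^ 7 * (n : ℝ)⁻¹ * (hNorm 6 h + hTildeNorm 3 h) := by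
  -- The constant is found separately for each index and each list, then turned into a function by
  -- choice. A list determines r and p.
  suffices H : ∀ (lam : ℝ) (l : List ℝ), ∃ C : ℝ, 0 < lam → ∀ (r : ℕ), 2 ≤ r →
      ∀ (p : Fin r → ℝ), List.ofFn p = l → (∀ j, 0 < p j) → ∑ j, p j = 1 →
      ∀ (n : ℕ), 1 ≤ n →
      ∀ (Ω : Type _) [MeasurableSpace Ω] (P : Measure Ω) [IsProbabilityMeasure P]
        (X : Fin n → Ω → Fin r), (∀ i, Measurable (X i)) → iIndepFun X P →
        (∀ i j, P.real {ω | X i ω = j} = p j) →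
      ∀ (h : ℝ → ℝ), MemCb 6 h →
        Integrable (fun ω => h (powerDivergence lam p fun i => X i ω)) P ∧
        Integrable h (chiSquare (r - 1)) ∧
        |(∫ ω, h (powerDivergence lam p fun i => X i ω) ∂P) - ∫ y, h y ∂(chiSquare (r - 1))|
          ≤ C * (r : ℝ) ^ 7 * (n : ℝ)⁻¹ * (hNorm 6 h + hTildeNorm 3 h) by
    choose C hC using H
    refine ⟨C, fun lam hlam r hr p hp hsum => hC lam (List.ofFn p) ?_ r hr p rfl hp hsum⟩
    rcases hlam with ⟨m, hm, rfl⟩ | h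
    · exact_mod_cast hm
    · linarith
  intro lam l
  by_cases hex : 0 < lam ∧ ∃ (d : ℕ) (p : Fin (d + 1) → ℝ), List.ofFn p = l ∧ (∀ j, 0 < p j) ∧
      ∑ j, p j = 1
  · obtain ⟨hl, d, p, hpl, hp, hsum⟩ := hex
    obtain ⟨C, hC, hbound⟩ := powerDivergence_chiSquare_bound hl hp hsum
    refine ⟨C, fun _ r _ p' hp' _ _ n hn Ω _ P _ X hX hind hlaw h hh => ?_⟩
    obtain rfl : r = d + 1 := by
      have := congrArg List.length (hp'.trans hpl.symm)
      simpa using this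
    obtain rfl : p' = p := List.ofFn_injective (hp'.trans hpl.symm)
    obtain ⟨h1, h2, h3⟩ := hbound n hn Ω P X hX hind hlaw h hh
    refine ⟨h1, h2, h3.trans ?_⟩
    have hr7 : (1 : ℝ) ≤ ((d + 1 : ℕ) : ℝ) ^ 7 :=
      one_le_pow₀ (by exact_mod_cast Nat.le_add_left 1 d)
    have hN := hNorm_nonneg 6 h
    have hT := hTildeNorm_nonneg 3 h
    calc C * (n : ℝ)⁻¹ * hNorm 6 h = C * 1 * (n : ℝ)⁻¹ * hNorm 6 h := by ring
      _ ≤ C * ((d + 1 : ℕ) : ℝ) ^ 7 * (n : ℝ)⁻¹ * (hNorm 6 h + hTildeNorm 3 h) := by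
        gcongr
        linarith
  -- The list is no positive probability vector or the index is not positive; the default 0 is
  -- harmless since the claim is vacuous.
  · refine ⟨0, fun hl r hr p hpl hp hsum => absurd ?_ hex⟩
    obtain ⟨d, rfl⟩ : ∃ d, r = d + 1 := ⟨r - 1, by omega⟩
    exact ⟨hl, d, p, hpl, hp, hsum⟩
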